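/- For an integer $n\ge 0$ let $\mathcal B_{3n}^3$ be the group of the permutations $w$ of $\{1,\dots,3n\}$ that send each triple $p_3(i)=\{3i-2,3i-1,3i\}$, $1\le i\le n$, onto a triple $p_3(j)$, and let $p_w\in\mathcal S_n$ be given by $p_w(i)=j$ if $w(p_3(i))=p_3(j)$. Cycles include fixed points. For each cycle of $p_w$, say of length $r$, the three elements of a triple $p_3(i)$ with $i$ in this cycle are distributed among the cycles of $w$ according to a partition $\rho\in\{(1,1,1),(2,1),(3)\}$ of $3$, which does not depend on $i$; let $w(\rho)$ be the partition formed by the lengths $r$ of the cycles of $p_w$ with distribution $\rho$. The type of $w$ is the triple of partitions $(w(1,1,1),w(2,1),w(3))$. For a triple of partitions $x=(\alpha,\beta,\gamma)$ put $|x|=|\alpha|+|\beta|+|\gamma|$, and call $x$ proper if $\alpha$ has no part equal to $1$. For $x$ proper and $n\ge|x|$ let $\mathbf C_x(n)\in Z(\mathbb C[\mathcal B_{3n}^3])$ be the sum of all elements of $\mathcal B_{3n}^3$ of type $(\alpha\cup(1^{n-|x|}),\beta,\gamma)$. Let $x_1=(\alpha_1,\beta_1,\gamma_1)$ and $x_2=(\alpha_2,\beta_2,\gamma_2)$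 be proper triples of partitions. For every $n\ge|x_1|,|x_2|$ there are unique coefficients $c_{x_1x_2}^{z}(n)\in\mathbb C$, the structure coefficients of the center of the group algebra, with $$\mathbf C_{x_1}(n)\,\mathbf C_{x_2}(n)=\sum_{z\text{ proper},\ |z|\le n}c_{x_1x_2}^{z}(n)\,\mathbf C_z(n).$$ For every proper triple $x_3=(\alpha_3,\beta_3,\gamma_3)$ there is a polynomial $P$ with rational coefficients such that $c_{x_1x_2}^{x_3}(n)=P(n)$ for all $n\ge|x_1|,|x_2|,|x_3|$, and $P$ has non-negative coefficients in the falling factorials of $n-|x_3|$, that is, $$P(n)=\sum_{j\ge0}a_j\,(n-|x_3|)(n-|x_3|-1)\cdots(n-|x_3|-j+1)$$ with finitely many nonzero rational numbers $a_j\ge0$ (independent of $n$). Moreover $$\deg P\le|x_1|+|x_2|-|x_3|,$$ where $\deg 0=-\infty$. -/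

import Mathlib

namespace BlockPermThree

/-! ### The group of block permutations -/

/-- The index of the triple containing `a`; the points are numbered from `0`, so that the `i`-th
triple is `{3 i, 3 i + 1, 3 i + 2}`. -/
def blockOf {n : ℕ} (a : Fin (3 * n)) : Fin n :=
  ⟨a.val / 3, by have := a.isLt; omega⟩

/-- The `i`-th triple `{3 i, 3 i + 1, 3 i + 2}`. -/
def block {n : ℕ} (i : Fin n) : Finset (Fin (3 * n)) :=
  Finset.univ.filter fun a => blockOf a = i

/-- The first element of the `i`-th triple. -/
def blockRep {n : ℕ} (i : Fin n) : Fin (3 * n) :=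
  ⟨3 * i.val, by have := i.isLt; omega⟩

theorem mem_block {n : ℕ} {i : Fin n} {a : Fin (3 * n)} : a ∈ block i ↔ blockOf a = i := by
  simp [block]

theorem blockOf_blockRep {n : ℕ} (i : Fin n) : blockOf (blockRep i) = i := by
  ext
  simp [blockOf, blockRep]

theorem blockOf_eq_of_maps {n : ℕ} {w : Equiv.Perm (Fin (3 * n))}
    (hw : ∀ r : Fin n, ∃ r' : Fin n, (block r).map w.toEmbedding = block r')
    {a b : Fin (3 * n)} (hab : blockOf a = blockOf b) : blockOf (w a) = blockOf (w b) := by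
  obtain ⟨r', hr'⟩ := hw (blockOf a)
  have ha : w a ∈ block r' := by
    rw [← hr']
    exact Finset.mem_map_of_mem w.toEmbedding (mem_block.2 rfl)
  have hb : w b ∈ block r' := by
    rw [← hr']
    exact Finset.mem_map_of_mem w.toEmbedding (mem_block.2 hab.symm)
  rw [mem_block.1 ha, mem_block.1 hb]

/-- The subgroup of the permutations of the `3 n` points that send every triple onto a triple. -/
def B (n : ℕ) : Subgroup (Equiv.Perm (Fin (3 * n))) where
  carrier := {w | ∀ r : Fin n, ∃ r' : Fin n, (block r).map w.toEmbedding = block r'}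
  one_mem' := by
    intro r
    refine ⟨r, ?_⟩
    exact Finset.map_refl
  mul_mem' := by
    intro u v hu hv r
    obtain ⟨s, hs⟩ := hv r
    obtain ⟨t, ht⟩ := hu s
    refine ⟨t, ?_⟩
    rw [← ht, ← hs, Finset.map_map]
    rfl
  inv_mem' := by
    intro w hw r
    have hsurj : Function.Surjective fun i : Fin n => blockOf (w (blockRep i)) := by
      intro j
      refine ⟨blockOf (w⁻¹ (blockRep j)), ?_⟩
      have := blockOf_eq_of_maps hw (blockOf_blockRep (blockOf (w⁻¹ (blockRep j))))
      simpa [blockOf_blockRep] using this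
    obtain ⟨s, hs⟩ := hsurj r
    obtain ⟨s', hs'⟩ := hw s
    have hmem : w (blockRep s) ∈ block s' := by
      rw [← hs']
      exact Finset.mem_map_of_mem w.toEmbedding (mem_block.2 (blockOf_blockRep s))
    have hsr : s' = r := by rw [← mem_block.1 hmem]; exact hs
    subst hsr
    refine ⟨s, ?_⟩
    rw [← hs', Finset.map_map]
    ext a
    simp

theorem blockOf_apply {n : ℕ} (w : B n) {a b : Fin (3 * n)} (hab : blockOf a = blockOf b) :
    blockOf (w.1 a) = blockOf (w.1 b) :=
  blockOf_eq_of_maps w.2 hab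

/-- The permutation of the triples induced by `w`. -/
def blockPerm {n : ℕ} (w : B n) : Equiv.Perm (Fin n) where
  toFun i := blockOf (w.1 (blockRep i))
  invFun i := blockOf (w⁻¹.1 (blockRep i))
  left_inv i := by
    have := blockOf_apply w⁻¹ (blockOf_blockRep (blockOf (w.1 (blockRep i))))
    simpa [blockOf_blockRep] using this
  right_inv i := by
    have := blockOf_apply w (blockOf_blockRep (blockOf (w⁻¹.1 (blockRep i))))
    simpa [blockOf_blockRep] using this

theorem blockPerm_blockOf {n : ℕ} (w : B n) (a : Fin (3 * n)) :
    blockPerm w (blockOf a) = blockOf (w.1 a) :=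
  blockOf_apply w (blockOf_blockRep (blockOf a))

theorem map_block {n : ℕ} (w : B n) (i : Fin n) :
    (block i).map w.1.toEmbedding = block (blockPerm w i) := by
  obtain ⟨j, hj⟩ := w.2 i
  have hmem : w.1 (blockRep i) ∈ block j := by
    rw [← hj]
    exact Finset.mem_map_of_mem w.1.toEmbedding (mem_block.2 (blockOf_blockRep i))
  rw [hj, ← mem_block.1 hmem]
  rfl

theorem blockPerm_mul {n : ℕ} (u v : B n) : blockPerm (u * v) = blockPerm u * blockPerm v := by
  ext1 i
  change blockOf (u.1 (v.1 (blockRep i))) = blockPerm u (blockOf (v.1 (blockRep i)))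
  rw [blockPerm_blockOf]

theorem blockPerm_conj {n : ℕ} (g w : B n) :
    blockPerm (g * w * g⁻¹) = blockPerm g * blockPerm w * (blockPerm g)⁻¹ := by
  rw [eq_mul_inv_iff_mul_eq, ← blockPerm_mul, ← blockPerm_mul]
  simp

/-! ### Cycles, fixed points included -/

/-- The set of elements of the cycle of `p` through `a` (`{a}` if `a` is a fixed point). -/
def cycleThrough {X : Type*} [Fintype X] [DecidableEq X] (p : Equiv.Perm X) (a : X) : Finset X :=
  Finset.univ.filter fun b => p.SameCycle a b

/-- The cycles of `p`, each given by its set of elements, fixed points included. -/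
def cycles {X : Type*} [Fintype X] [DecidableEq X] (p : Equiv.Perm X) : Finset (Finset X) :=
  Finset.univ.image (cycleThrough p)

theorem cycleThrough_conj {X : Type*} [Fintype X] [DecidableEq X] (g p : Equiv.Perm X) (a : X) :
    cycleThrough (g * p * g⁻¹) (g a) = (cycleThrough p a).map g.toEmbedding := by
  ext b
  have hg : g⁻¹ (g a) = a := g.symm_apply_apply a
  simp only [cycleThrough, Finset.mem_filter, Finset.mem_univ, true_and, Finset.mem_map_equiv,
    Equiv.Perm.sameCycle_conj, hg]
  rfl

theorem cycles_conj {X : Type*} [Fintype X] [DecidableEq X] (g p : Equiv.Perm X) :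
    cycles (g * p * g⁻¹) = (cycles p).map (Finset.mapEmbedding g.toEmbedding).toEmbedding := by
  ext O
  simp only [cycles, Finset.mem_image, Finset.mem_univ, true_and, Finset.mem_map]
  constructor
  · rintro ⟨b, rfl⟩
    refine ⟨cycleThrough p (g⁻¹ b), ⟨_, rfl⟩, ?_⟩
    have := cycleThrough_conj g p (g⁻¹ b)
    have hg : g (g⁻¹ b) = b := g.apply_symm_apply b
    rw [hg] at this
    rw [this]
    rfl
  · rintro ⟨_, ⟨a, rfl⟩, rfl⟩
    exact ⟨g a, cycleThrough_conj g p a⟩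

theorem card_pos_of_mem_cycles {X : Type*} [Fintype X] [DecidableEq X] {p : Equiv.Perm X}
    {O : Finset X} (hO : O ∈ cycles p) : 0 < O.card := by
  simp only [cycles, Finset.mem_image, Finset.mem_univ, true_and] at hO
  obtain ⟨a, rfl⟩ := hO
  exact Finset.card_pos.2 ⟨a, by simp [cycleThrough, Equiv.Perm.SameCycle.refl]⟩

/-! ### The type of a block permutation -/

/-- The way the three points of the `i`-th triple are distributed among the cycles of `w`: the
partition of `3` formed by the sizes of the nonempty intersections of the triple with cycles. -/
def distribution {n : ℕ} (w : B n) (i : Fin n) : Multiset ℕ :=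
  ((block i).image (cycleThrough w.1)).val.map fun c => (c ∩ block i).card

/-- The parts of the partition `w(ρ)`: the lengths of those cycles of the permutation of the
triples whose triples are distributed among the cycles of `w` according to `ρ`. -/
def typeParts {n : ℕ} (w : B n) (ρ : Multiset ℕ) : Multiset ℕ :=
  ((cycles (blockPerm w)).filter fun O => ∀ i ∈ O, distribution w i = ρ).val.map Finset.card

theorem typeParts_pos {n : ℕ} (w : B n) (ρ : Multiset ℕ) {r : ℕ} (hr : r ∈ typeParts w ρ) :
    0 < r := by
  simp only [typeParts, Multiset.mem_map, Finset.mem_val, Finset.mem_filter] at hr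
  obtain ⟨O, ⟨hO, -⟩, rfl⟩ := hr
  exact card_pos_of_mem_cycles hO

/-- A triple `(α, β, γ)` of integer partitions, each together with its size. -/
@[ext]
structure PartitionTriple where
  α : Σ a : ℕ, a.Partition
  β : Σ b : ℕ, b.Partition
  γ : Σ c : ℕ, c.Partition

/-- The size `|α| + |β| + |γ|`. -/
def PartitionTriple.size (x : PartitionTriple) : ℕ := x.α.1 + x.β.1 + x.γ.1

/-- `(α, β, γ)` is proper if `α` has no part equal to `1`. -/
def PartitionTriple.IsProper (x : PartitionTriple) : Prop := 1 ∉ x.α.2.parts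

/-- The triple `(α ∪ (1^{n - |x|}), β, γ)`, for `n` at least the size `|x|`. -/
def PartitionTriple.complete (x : PartitionTriple) (n : ℕ) : PartitionTriple where
  α := ⟨x.α.1 + (n - x.size),
    { parts := x.α.2.parts + Multiset.replicate (n - x.size) 1
      parts_pos := by
        intro i hi
        rcases Multiset.mem_add.1 hi with h | h
        · exact x.α.2.parts_pos h
        · rw [Multiset.eq_of_mem_replicate h]
          exact Nat.one_pos
      parts_sum := by simp [x.α.2.parts_sum] }⟩
  β := x.β
  γ := x.γ

/-- The partition with the parts `typeParts w ρ`. -/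
def typePartition {n : ℕ} (w : B n) (ρ : Multiset ℕ) : Σ m : ℕ, m.Partition :=
  ⟨(typeParts w ρ).sum,
    { parts := typeParts w ρ
      parts_pos := fun h => typeParts_pos w ρ h
      parts_sum := rfl }⟩

/-- The type `(w(1,1,1), w(2,1), w(3))` of `w`. -/
def type {n : ℕ} (w : B n) : PartitionTriple where
  α := typePartition w {1, 1, 1}
  β := typePartition w {2, 1}
  γ := typePartition w {3}

theorem distribution_conj {n : ℕ} (g w : B n) (i : Fin n) :
    distribution (g * w * g⁻¹) (blockPerm g i) = distribution w i := by
  have himg : (block (blockPerm g i)).image (cycleThrough (g * w * g⁻¹).1)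
      = ((block i).image (cycleThrough w.1)).map
          (Finset.mapEmbedding g.1.toEmbedding).toEmbedding := by
    rw [← map_block, Finset.map_eq_image, Finset.map_eq_image, Finset.image_image,
      Finset.image_image]
    refine Finset.image_congr fun a _ => ?_
    exact cycleThrough_conj g.1 w.1 a
  unfold distribution
  rw [himg, Finset.map_val, Multiset.map_map]
  refine Multiset.map_congr rfl fun c _ => ?_
  change ((c.map g.1.toEmbedding) ∩ block (blockPerm g i)).card = _
  rw [← map_block, ← Finset.map_inter, Finset.card_map]

theorem typeParts_conj {n : ℕ} (g w : B n) (ρ : Multiset ℕ) :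
    typeParts (g * w * g⁻¹) ρ = typeParts w ρ := by
  unfold typeParts
  rw [blockPerm_conj, cycles_conj, Finset.filter_map, Finset.map_val, Multiset.map_map]
  have hf : (cycles (blockPerm w)).filter
        ((fun O => ∀ i ∈ O, distribution (g * w * g⁻¹) i = ρ) ∘
          (Finset.mapEmbedding (blockPerm g).toEmbedding).toEmbedding)
      = (cycles (blockPerm w)).filter fun O => ∀ i ∈ O, distribution w i = ρ := by
    refine Finset.filter_congr fun O _ => ?_
    change (∀ i ∈ O.map (blockPerm g).toEmbedding, _) ↔ _
    rw [Finset.forall_mem_map]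
    refine forall₂_congr fun i _ => ?_
    change distribution (g * w * g⁻¹) (blockPerm g i) = ρ ↔ _
    rw [distribution_conj]
  rw [hf]
  refine Multiset.map_congr rfl fun O _ => ?_
  exact Finset.card_map _

theorem type_conj {n : ℕ} (g w : B n) : type (g * w * g⁻¹) = type w := by
  have h : ∀ ρ, typePartition (g * w * g⁻¹) ρ = typePartition w ρ := by
    intro ρ
    have key : ∀ (s t : Multiset ℕ) (hs : ∀ {i}, i ∈ s → 0 < i) (ht : ∀ {i}, i ∈ t → 0 < i),
        s = t → (⟨s.sum, ⟨s, hs, rfl⟩⟩ : Σ m : ℕ, m.Partition) = ⟨t.sum, ⟨t, ht, rfl⟩⟩ := by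
      rintro s _ _ _ rfl
      rfl
    exact key _ _ _ _ (typeParts_conj g w ρ)
  simp only [type, h]

/-! ### The center of the group algebra and its structure coefficients -/

/-- The conjugacy class `C_x(n)`: the elements whose type is `x` with parts equal to `1` added to
its first partition. -/
noncomputable def conjClass (n : ℕ) (x : PartitionTriple) : Finset (B n) := by
  classical exact Finset.univ.filter fun t => type t = x.complete n

theorem mem_conjClass {n : ℕ} {x : PartitionTriple} {t : B n} :
    t ∈ conjClass n x ↔ type t = x.complete n := by
  simp [conjClass]

/-- The center of the group algebra over the complex numbers. -/
noncomputable abbrev CenterAlg (n : ℕ) : Subalgebra ℂ (MonoidAlgebra ℂ (B n)) :=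
  Subalgebra.center ℂ (MonoidAlgebra ℂ (B n))

theorem classSum_mem_center (n : ℕ) (x : PartitionTriple) :
    (∑ t ∈ conjClass n x, MonoidAlgebra.of ℂ (B n) t) ∈ CenterAlg n := by
  rw [Subalgebra.mem_center_iff]
  intro b
  induction b using MonoidAlgebra.induction_on with
  | of g =>
    rw [Finset.mul_sum, Finset.sum_mul]
    refine Finset.sum_bij' (fun t _ => g * t * g⁻¹) (fun t _ => g⁻¹ * t * g) ?_ ?_ ?_ ?_ ?_
    · intro t ht
      rw [mem_conjClass] at ht ⊢
      rw [type_conj, ht]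
    · intro t ht
      rw [mem_conjClass] at ht ⊢
      have := type_conj g⁻¹ t
      rw [inv_inv] at this
      rw [this, ht]
    · intro t _
      group
    · intro t _
      group
    · intro t _
      rw [← map_mul, ← map_mul]
      congr 1
      group
  | add f g hf hg => rw [add_mul, mul_add, hf, hg]
  | smul r f hf => rw [smul_mul_assoc, mul_smul_comm, hf]

/-- The formal sum of the elements of the class `C_x(n)`, as an element of the center. -/
noncomputable def classSum (n : ℕ) (x : PartitionTriple) : CenterAlg n :=
  ⟨∑ t ∈ conjClass n x, MonoidAlgebra.of ℂ (B n) t, classSum_mem_center n x⟩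

/-- The proper triples of size at most `n`, which index the conjugacy classes of `B n`. -/
abbrev Index (n : ℕ) : Type := {z : PartitionTriple // z.IsProper ∧ z.size ≤ n}

/-- `c` is the family of the structure coefficients `c_{xy}^z(n)`, `z` running over the proper
triples of size at most `n`: the product of the class sums of `x` and `y` is
`∑ z, c z • classSum n z`. -/
def IsStructureCoefficients (n : ℕ) (x y : PartitionTriple) (c : Index n →₀ ℂ) : Prop :=
  classSum n x * classSum n y = c.sum fun z r => r • classSum n z.1

end BlockPermThree

/-! Comparing coefficients at a group element `w` of type `h.complete n`, the structure coefficient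
of `h` is the number of factorizations `w = u * v` with `u` and `v` in the classes of `x` and `y`
(`isStructureCoefficients_iff`). The dependence on `n` is isolated by sorting factorizations by the
set `T` of blocks that `u` or `v` does not fix pointwise.

This set contains `supp w`, which has `h.size` elements because `h` is proper. Outside `T` both
factors are the identity, so restriction to `T` identifies the factorizations belonging to `T` with
factorizations in `B T.card` whose supports cover all blocks. Their number `spanningCount x y h
T.card` does not involve `n`. There are `(n - h.size).choose j` sets `T` of size `h.size + j`, so
the coefficient is `∑ j, (n - h.size).choose j * spanningCount x y h (h.size + j)`
(`card_factorizations`). Each binomial is a falling factorial of `n - h.size` divided by `j!`, which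
gives the nonnegative expansion. The supports of `u` and `v` have `x.size` and `y.size` elements, so
no term with `h.size + j > x.size + y.size` survives; this is the degree bound.

The counts must depend on the type of `w` only, so elements of equal type have to be conjugate
(`exists_conj_of_typeParts_eq`). A block permutation is determined up to conjugacy by the cycles of
`blockPerm w` and, over each of them, the cycle lengths of the return map on one block, which form
the distribution. Uniqueness of the coefficients also needs every type of size at most `n` to be
realized (`exists_type_eq_complete`). -/

namespace BlockPermThree

/-! ### Cycles of a permutation -/

section Cycles

variable {X : Type*} [Fintype X] [DecidableEq X]

theorem mem_cycleThrough {p : Equiv.Perm X} {a b : X} :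
    b ∈ cycleThrough p a ↔ p.SameCycle a b := by
  simp [cycleThrough]

theorem cycleThrough_eq_iff {p : Equiv.Perm X} {a b : X} :
    cycleThrough p a = cycleThrough p b ↔ p.SameCycle a b := by
  constructor
  · intro h
    rw [← mem_cycleThrough, h, mem_cycleThrough]
  · intro h
    ext c
    rw [mem_cycleThrough, mem_cycleThrough]
    exact ⟨h.symm.trans, h.trans⟩

theorem cycleThrough_mem_cycles (p : Equiv.Perm X) (a : X) : cycleThrough p a ∈ cycles p :=
  Finset.mem_image_of_mem _ (Finset.mem_univ a)

theorem eq_cycleThrough_of_mem {p : Equiv.Perm X} {O : Finset X} (hO : O ∈ cycles p) {a : X}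
    (ha : a ∈ O) : O = cycleThrough p a := by
  simp only [cycles, Finset.mem_image, Finset.mem_univ, true_and] at hO
  obtain ⟨b, rfl⟩ := hO
  exact cycleThrough_eq_iff.2 (mem_cycleThrough.1 ha)

/-- The cycle is the orbit of `a` under the powers of `p`, so its size is the minimal period of `a`.
-/
theorem zpow_apply_eq_self_iff (p : Equiv.Perm X) (a : X) (k : ℤ) :
    (p ^ k) a = a ↔ ((cycleThrough p a).card : ℤ) ∣ k := by
  have h1 := MulAction.zpow_smul_eq_iff_minimalPeriod_dvd (a := p) (b := a) (n := k)
  have : Fintype (MulAction.orbit (Subgroup.zpowers p) a) := Fintype.ofFinite _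
  have h2 : (cycleThrough p a).card = Function.minimalPeriod (p • ·) a := by
    rw [MulAction.minimalPeriod_eq_card, ← Set.toFinset_card]
    congr 1
    ext b
    rw [mem_cycleThrough, Set.mem_toFinset, MulAction.mem_orbit_iff]
    constructor
    · rintro ⟨i, rfl⟩
      exact ⟨⟨p ^ i, i, rfl⟩, rfl⟩
    · rintro ⟨⟨_, i, rfl⟩, rfl⟩
      exact ⟨i, rfl⟩
  rw [h2, ← h1]
  rfl

theorem sum_map_card_cycles (p : Equiv.Perm X) :
    ((cycles p).val.map Finset.card).sum = Fintype.card X := by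
  change ∑ O ∈ cycles p, O.card = _
  rw [← Finset.card_univ, Finset.card_eq_sum_card_image (cycleThrough p) Finset.univ]
  refine Finset.sum_congr rfl fun O hO => ?_
  congr 1
  ext a
  simp only [Finset.mem_filter, Finset.mem_univ, true_and]
  constructor
  · exact fun ha => (eq_cycleThrough_of_mem hO ha).symm
  · rintro rfl
    exact mem_cycleThrough.2 (Equiv.Perm.SameCycle.refl _ _)

end Cycles

/-- Besides projections of points to blocks, `π` is later an invariant (with `p = 1`) or an
equivariant bijection. -/
theorem proj_zpow {A Y : Type*} {π : A → Y} {w : Equiv.Perm A} {p : Equiv.Perm Y} (hπ : ∀ a, π (w a) = p (π a))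
    (k : ℤ) (a : A) : π ((w ^ k) a) = (p ^ k) (π a) := by
  have hinv : ∀ a, π (w⁻¹ a) = p⁻¹ (π a) := fun a => by
    rw [Equiv.Perm.eq_inv_iff_eq, ← hπ]
    simp
  induction k using Int.induction_on generalizing a with
  | zero => rfl
  | succ i ih => rw [zpow_add_one, zpow_add_one, Equiv.Perm.mul_apply, ih, hπ, Equiv.Perm.mul_apply]
  | pred i ih =>
    rw [zpow_sub_one, zpow_sub_one, Equiv.Perm.mul_apply, ih, hinv, Equiv.Perm.mul_apply]

theorem zpow_apply_eq_zpow_apply_iff {Z : Type*} (q : Equiv.Perm Z) (k l : ℤ) (x y : Z) :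
    (q ^ k) x = (q ^ l) y ↔ (q ^ (k - l)) x = y := by
  rw [sub_eq_neg_add, zpow_add, Equiv.Perm.mul_apply, zpow_neg, Equiv.Perm.inv_eq_iff_eq]

/-! ### Conjugacy of permutations lying over permutations -/

section Conjugation

variable {A A' Y Y' : Type*} [Fintype A] [Fintype A'] [Fintype Y] [Fintype Y'] [DecidableEq Y]
  [DecidableEq Y']

/-- An isomorphism of permutations over permutations, assembled from a bijection of the cycles of
the bases and isomorphisms of the return maps on one fibre over each cycle. -/
theorem exists_equivariant_equiv {π : A → Y} {w : Equiv.Perm A} {p : Equiv.Perm Y}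
    (hπ : ∀ a, π (w a) = p (π a)) {π' : A' → Y'} {w' : Equiv.Perm A'} {p' : Equiv.Perm Y'}
    (hπ' : ∀ a, π' (w' a) = p' (π' a)) (hA : Fintype.card A = Fintype.card A')
    (e : {O // O ∈ cycles p} → {O // O ∈ cycles p'}) (he : Function.Injective e)
    (hcard : ∀ O, (e O).1.card = O.1.card)
    (b : {O // O ∈ cycles p} → Y) (hb : ∀ O, b O ∈ O.1)
    (b' : {O // O ∈ cycles p} → Y') (hb' : ∀ O, b' O ∈ (e O).1)
    (φ : ∀ O, {x // π x = b O} → A') (hφ : ∀ O x, π' (φ O x) = b' O)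
    (hinj : ∀ O, Function.Injective (φ O))
    (hcomm : ∀ O (m : ℤ) (x y : {x // π x = b O}), y.1 = (w ^ ((O.1.card : ℤ) * m)) x.1 →
      φ O y = (w' ^ ((O.1.card : ℤ) * m)) (φ O x)) :
    ∃ g : A ≃ A', (∀ a, g (w a) = w' (g a)) ∧ ∀ a c, π a = π c → π' (g a) = π' (g c) := by
  have hOb : ∀ O, O.1 = cycleThrough p (b O) := fun O => eq_cycleThrough_of_mem O.2 (hb O)
  have hOb' : ∀ O, (e O).1 = cycleThrough p' (b' O) :=
    fun O => eq_cycleThrough_of_mem (e O).2 (hb' O)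
  have hret : ∀ O (k : ℤ), (p ^ k) (b O) = b O ↔ (O.1.card : ℤ) ∣ k := fun O k => by
    rw [zpow_apply_eq_self_iff, ← hOb]
  have hret' : ∀ O (k : ℤ), (p' ^ k) (b' O) = b' O ↔ (O.1.card : ℤ) ∣ k := fun O k => by
    rw [zpow_apply_eq_self_iff, ← hOb', hcard]
  -- Every point is reached by a power of `w` from the chosen fibre over its cycle.
  have hcov : ∀ a : A, ∃ (O : {O // O ∈ cycles p}) (k : ℤ) (x : {x // π x = b O}),
      (w ^ k) x.1 = a := by
    intro a
    let O : {O // O ∈ cycles p} := ⟨_, cycleThrough_mem_cycles p (π a)⟩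
    obtain ⟨k, hk⟩ := mem_cycleThrough.1 (hb O)
    refine ⟨O, -k, ⟨(w ^ k) a, ?_⟩, ?_⟩
    · rw [proj_zpow hπ, hk]
    · simp [zpow_neg]
  have hsame : ∀ O O' (k l : ℤ), (p ^ k) (b O) = (p ^ l) (b O') → O = O' := by
    intro O O' k l h
    apply Subtype.ext
    rw [hOb O, hOb O', cycleThrough_eq_iff]
    exact ⟨-l + k, by rw [zpow_add, Equiv.Perm.mul_apply, h]; simp [zpow_neg]⟩
  have hsame' : ∀ O O' (k l : ℤ), (p' ^ k) (b' O) = (p' ^ l) (b' O') → O = O' := by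
    intro O O' k l h
    apply he
    apply Subtype.ext
    rw [hOb' O, hOb' O', cycleThrough_eq_iff]
    exact ⟨-l + k, by rw [zpow_add, Equiv.Perm.mul_apply, h]; simp [zpow_neg]⟩
  -- Two presentations name the same point exactly when their intended images agree: one direction
  -- makes the map well defined, the other makes it injective.
  have hwd : ∀ O O' (k l : ℤ) (x : {x // π x = b O}) (y : {x // π x = b O'}),
      (w ^ k) x.1 = (w ^ l) y.1 ↔ (w' ^ k) (φ O x) = (w' ^ l) (φ O' y) := by
    intro O O' k l x y
    constructor
    · intro h
      have h1 := congrArg π h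
      rw [proj_zpow hπ, proj_zpow hπ, x.2, y.2] at h1
      obtain rfl := hsame _ _ _ _ h1
      rw [zpow_apply_eq_zpow_apply_iff, hret] at h1
      obtain ⟨m, hm⟩ := h1
      rw [zpow_apply_eq_zpow_apply_iff, hm] at h ⊢
      exact (hcomm O m x y h.symm).symm
    · intro h
      have h1 := congrArg π' h
      rw [proj_zpow hπ', proj_zpow hπ', hφ, hφ] at h1
      obtain rfl := hsame' _ _ _ _ h1
      rw [zpow_apply_eq_zpow_apply_iff, hret', ← hret] at h1
      -- So `w ^ (k - l)` brings `x` back to the chosen fibre, where `hcomm` and the injectivity of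
      -- `φ O` compare the result with `y`.
      have hx : π ((w ^ (k - l)) x.1) = b O := by rw [proj_zpow hπ, x.2, h1]
      rw [hret] at h1
      obtain ⟨m, hm⟩ := h1
      rw [zpow_apply_eq_zpow_apply_iff, hm] at h
      rw [zpow_apply_eq_zpow_apply_iff, hm]
      rw [hm] at hx
      have h2 := hcomm O m x ⟨_, hx⟩ rfl
      exact congrArg Subtype.val (hinj O (h2.trans h))
  choose O k x hx using hcov
  -- The power of `w` is replaced by the same power of `w'`; by `hwd` the choice of presentation is
  -- irrelevant.
  let g : A → A' := fun a => (w' ^ k a) (φ (O a) (x a))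
  have hg : ∀ a Q (l : ℤ) (y : {x // π x = b Q}), (w ^ l) y.1 = a → g a = (w' ^ l) (φ Q y) := by
    intro a Q l y h
    exact (hwd _ _ _ _ _ _).1 ((hx a).trans h.symm)
  have hgi : Function.Injective g := by
    intro a c h
    rw [← hx a, ← hx c]
    exact (hwd _ _ _ _ _ _).2 h
  refine ⟨Equiv.ofBijective g ((Fintype.bijective_iff_injective_and_card g).2 ⟨hgi, hA⟩), ?_, ?_⟩
  · intro a
    change g (w a) = w' (g a)
    rw [hg (w a) (O a) (1 + k a) (x a) (by rw [zpow_add, Equiv.Perm.mul_apply, hx a]; rfl),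
      zpow_add]
    rfl
  · intro a c h
    change π' ((w' ^ k a) (φ (O a) (x a))) = π' ((w' ^ k c) (φ (O c) (x c)))
    rw [proj_zpow hπ', proj_zpow hπ', hφ, hφ]
    rw [← hx a, ← hx c, proj_zpow hπ, proj_zpow hπ, (x a).2, (x c).2] at h
    have hO := hsame _ _ _ _ h
    rw [← hO] at h ⊢
    rw [zpow_apply_eq_zpow_apply_iff, hret, ← hret', ← zpow_apply_eq_zpow_apply_iff] at h
    exact h

theorem exists_fiber_equiv {α β K : Type*} [Fintype α] [Fintype β] [DecidableEq K] (f : α → K)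
    (g : β → K) (h : ∀ c, (Finset.univ.filter fun a => f a = c).card
      = (Finset.univ.filter fun b => g b = c).card) :
    ∃ e : α ≃ β, ∀ a, g (e a) = f a := by
  have key : ∀ c, Nonempty ({a // f a = c} ≃ {b // g b = c}) := fun c =>
    ⟨Fintype.equivOfCardEq (by rw [Fintype.card_subtype, Fintype.card_subtype, h])⟩
  exact ⟨Equiv.ofFiberEquiv fun c => (key c).some, fun a => Equiv.ofFiberEquiv_map _ a⟩

theorem card_filter_attach {α : Type*} [DecidableEq α] (s : Finset α) (P : α → Prop)
    [DecidablePred P] :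
    (Finset.univ.filter fun a : {a // a ∈ s} => P a.1).card = (s.filter P).card := by
  rw [← Finset.card_map (Function.Embedding.subtype _)]
  congr 1
  ext a
  simp [and_comm]

theorem count_map_card {α : Type*} (s : Finset (Finset α)) (r : ℕ) :
    (s.val.map Finset.card).count r = (s.filter fun O => O.card = r).card := by
  rw [Multiset.count_map, ← Finset.filter_val, ← Finset.card_def]
  congr 1
  exact Finset.filter_congr fun O _ => eq_comm

/-- Permutations with the same cycle lengths are conjugate. -/
theorem exists_conj_of_map_card_cycles_eq (p : Equiv.Perm Y) (p' : Equiv.Perm Y')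
    (h : (cycles p).val.map Finset.card = (cycles p').val.map Finset.card) :
    ∃ g : Y ≃ Y', ∀ a, g (p a) = p' (g a) := by
  obtain ⟨e, he⟩ := exists_fiber_equiv (fun O : {O // O ∈ cycles p} => O.1.card)
    (fun O : {O // O ∈ cycles p'} => O.1.card) (fun c => by
      rw [card_filter_attach (cycles p) fun O => O.card = c,
        card_filter_attach (cycles p') fun O => O.card = c, ← count_map_card, ← count_map_card, h])
  have hne : ∀ O : {O // O ∈ cycles p}, ∃ i, i ∈ O.1 := fun O =>
    Finset.card_pos.1 (card_pos_of_mem_cycles O.2)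
  have hne' : ∀ O : {O // O ∈ cycles p}, ∃ i, i ∈ (e O).1 := fun O =>
    Finset.card_pos.1 (card_pos_of_mem_cycles (e O).2)
  choose b hb using hne
  choose b' hb' using hne'
  have hY : Fintype.card Y = Fintype.card Y' := by
    rw [← sum_map_card_cycles p, h, sum_map_card_cycles]
  -- Over the identity projection the fibres are single points, and the return maps are trivial.
  obtain ⟨g, hg, -⟩ := exists_equivariant_equiv (π := id) (π' := id) (w := p) (w' := p')
    (fun _ => rfl) (fun _ => rfl) hY e e.injective he b hb b' hb' (fun O _ => b' O)
    (fun _ _ => rfl) (fun O x y _ => Subtype.ext (x.2.trans y.2.symm)) (by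
      intro O m x y _
      symm
      rw [zpow_apply_eq_self_iff, ← eq_cycleThrough_of_mem (e O).2 (hb' O), he]
      exact dvd_mul_right _ _)
  exact ⟨g, hg⟩

end Conjugation

/-! ### Distributions and types for arbitrary fibrations -/

section Systems

variable {A A' Y Y' : Type*} [Fintype A] [Fintype A'] [Fintype Y] [Fintype Y'] [DecidableEq A]
  [DecidableEq A'] [DecidableEq Y] [DecidableEq Y']

/-- The distribution among the cycles of `w` of the points of the fibre of `π` over `i`. -/
def fiberDistribution (π : A → Y) (w : Equiv.Perm A) (i : Y) : Multiset ℕ :=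
  ((Finset.univ.filter fun a => π a = i).image (cycleThrough w)).val.map
    fun c => (c ∩ Finset.univ.filter fun a => π a = i).card

/-- The lengths of the cycles of `p` over which the fibres of `π` have distribution `ρ`. -/
def fiberTypeParts (π : A → Y) (w : Equiv.Perm A) (p : Equiv.Perm Y) (ρ : Multiset ℕ) :
    Multiset ℕ :=
  ((cycles p).filter fun O => ∀ i ∈ O, fiberDistribution π w i = ρ).val.map Finset.card

theorem distribution_eq {n : ℕ} (w : B n) (i : Fin n) :
    distribution w i = fiberDistribution blockOf w.1 i := rfl

theorem typeParts_eq {n : ℕ} (w : B n) (ρ : Multiset ℕ) :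
    typeParts w ρ = fiberTypeParts blockOf w.1 (blockPerm w) ρ := by
  unfold typeParts fiberTypeParts
  congr!

/-- Pulling back along `j` matches the cycles of `w` that meet the fibre with the cycles of `q`,
preserving the sizes of intersections. It serves for return maps, for the model cycles and for fixed
blocks. -/
theorem fiberDistribution_eq_map_card_cycles {A Y Y' : Type*} [Fintype A]
    [Fintype Y'] [DecidableEq A] [DecidableEq Y] [DecidableEq Y'] {π : A → Y} {w : Equiv.Perm A} {i : Y}
    (q : Equiv.Perm Y') (j : Y' → A) (hj : Function.Injective j)
    (hrange : ∀ a, π a = i ↔ ∃ x, j x = a)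
    (hq : ∀ x y, w.SameCycle (j x) (j y) ↔ q.SameCycle x y) :
    fiberDistribution π w i = (cycles q).val.map Finset.card := by
  let P : Finset A → Finset Y' := fun c => Finset.univ.filter fun y => j y ∈ c
  have hF : (Finset.univ.filter fun a => π a = i) = Finset.univ.image j := by
    ext a
    simp [hrange]
  have hpre : ∀ x, P (cycleThrough w (j x)) = cycleThrough q x := by
    intro x
    ext y
    simp [P, mem_cycleThrough, hq]
  have hc : cycles q = ((Finset.univ.image j).image (cycleThrough w)).image P := by
    rw [Finset.image_image, Finset.image_image]
    exact Finset.image_congr fun x _ => (hpre x).symm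
  unfold fiberDistribution
  rw [hF, hc, Finset.image_val_of_injOn (f := P), Multiset.map_map]
  · refine Multiset.map_congr rfl fun c _ => ?_
    rw [Function.comp_apply, ← Finset.card_image_of_injective _ hj]
    congr 1
    ext a
    simp only [Finset.mem_inter, Finset.mem_image, Finset.mem_univ, true_and, Finset.mem_filter, P]
    constructor
    · rintro ⟨h, x, rfl⟩
      exact ⟨x, h, rfl⟩
    · rintro ⟨x, h, rfl⟩
      exact ⟨h, x, rfl⟩
  · intro c hc c' hc' h
    simp only [Finset.coe_image, Finset.coe_univ, Set.image_univ, Set.mem_image,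
      Set.mem_range, exists_exists_eq_and] at hc hc'
    obtain ⟨x, rfl⟩ := hc
    obtain ⟨y, rfl⟩ := hc'
    rw [hpre, hpre, cycleThrough_eq_iff] at h
    rw [cycleThrough_eq_iff, hq]
    exact h

theorem cycleThrough_map (f : Y ↪ Y') {p : Equiv.Perm Y} {p' : Equiv.Perm Y'}
    (h : ∀ i, p' (f i) = f (p i)) (i : Y) :
    cycleThrough p' (f i) = (cycleThrough p i).map f := by
  have hz : ∀ (k : ℤ) i, f ((p ^ k) i) = (p' ^ k) (f i) :=
    fun k i => proj_zpow (fun a => (h a).symm) k i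
  ext a
  simp only [mem_cycleThrough, Finset.mem_map]
  constructor
  · rintro ⟨k, rfl⟩
    exact ⟨(p ^ k) i, ⟨k, rfl⟩, hz k i⟩
  · rintro ⟨_, ⟨k, rfl⟩, rfl⟩
    exact ⟨k, (hz k i).symm⟩

theorem fiberDistribution_map {A A' Y Y' : Type*} [Fintype A] [Fintype A'] [DecidableEq A]
    [DecidableEq A'] [DecidableEq Y] [DecidableEq Y'] {π : A → Y} {w : Equiv.Perm A} {π' : A' → Y'} {w' : Equiv.Perm A'}
    (e : A ↪ A') (f : Y ↪ Y') (hπ : ∀ a, π' (e a) = f (π a)) (hw : ∀ a, w' (e a) = e (w a))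
    (hcov : ∀ a' i, π' a' = f i → ∃ a, e a = a') (i : Y) :
    fiberDistribution π' w' (f i) = fiberDistribution π w i := by
  have hF : (Finset.univ.filter fun a => π' a = f i)
      = (Finset.univ.filter fun a => π a = i).map e := by
    ext a'
    simp only [Finset.mem_filter, Finset.mem_univ, true_and, Finset.mem_map]
    constructor
    · intro h
      obtain ⟨a, rfl⟩ := hcov a' i h
      rw [hπ] at h
      exact ⟨a, f.injective h, rfl⟩
    · rintro ⟨a, rfl, rfl⟩
      exact hπ a
  have himg : ((Finset.univ.filter fun a => π' a = f i)).image (cycleThrough w')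
      = ((Finset.univ.filter fun a => π a = i).image (cycleThrough w)).map
          (Finset.mapEmbedding e).toEmbedding := by
    rw [hF, Finset.map_eq_image, Finset.map_eq_image, Finset.image_image, Finset.image_image]
    exact Finset.image_congr fun a _ => cycleThrough_map e hw a
  unfold fiberDistribution
  rw [himg, Finset.map_val, Multiset.map_map]
  refine Multiset.map_congr rfl fun c _ => ?_
  change ((c.map e) ∩ _).card = _
  rw [hF, ← Finset.map_inter, Finset.card_map]

variable {A₁ A₂ Y₁ Y₂ : Type*} [Fintype A₁] [Fintype A₂] [Fintype Y₁] [Fintype Y₂]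
  [DecidableEq A₁] [DecidableEq A₂] [DecidableEq Y₁] [DecidableEq Y₂]

/-- The type of a disjoint union. -/
theorem fiberTypeParts_add {π : A → Y} {w : Equiv.Perm A} {p : Equiv.Perm Y}
    {π₁ : A₁ → Y₁} {w₁ : Equiv.Perm A₁} {p₁ : Equiv.Perm Y₁}
    {π₂ : A₂ → Y₂} {w₂ : Equiv.Perm A₂} {p₂ : Equiv.Perm Y₂}
    (e₁ : A₁ ↪ A) (f₁ : Y₁ ↪ Y) (hπ₁ : ∀ a, π (e₁ a) = f₁ (π₁ a)) (hw₁ : ∀ a, w (e₁ a) = e₁ (w₁ a))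
    (hp₁ : ∀ i, p (f₁ i) = f₁ (p₁ i)) (hcov₁ : ∀ a i, π a = f₁ i → ∃ b, e₁ b = a)
    (e₂ : A₂ ↪ A) (f₂ : Y₂ ↪ Y) (hπ₂ : ∀ a, π (e₂ a) = f₂ (π₂ a)) (hw₂ : ∀ a, w (e₂ a) = e₂ (w₂ a))
    (hp₂ : ∀ i, p (f₂ i) = f₂ (p₂ i)) (hcov₂ : ∀ a i, π a = f₂ i → ∃ b, e₂ b = a)
    (hdisj : ∀ i j, f₁ i ≠ f₂ j) (hcov : ∀ i, (∃ j, f₁ j = i) ∨ ∃ j, f₂ j = i) (ρ : Multiset ℕ) :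
    fiberTypeParts π w p ρ = fiberTypeParts π₁ w₁ p₁ ρ + fiberTypeParts π₂ w₂ p₂ ρ := by
  let g₁ : Finset Y₁ ↪ Finset Y := (Finset.mapEmbedding f₁).toEmbedding
  let g₂ : Finset Y₂ ↪ Finset Y := (Finset.mapEmbedding f₂).toEmbedding
  let F₁ := (cycles p₁).filter fun O => ∀ i ∈ O, fiberDistribution π₁ w₁ i = ρ
  let F₂ := (cycles p₂).filter fun O => ∀ i ∈ O, fiberDistribution π₂ w₂ i = ρ
  have hD₁ : ∀ O : Finset Y₁, (∀ i ∈ g₁ O, fiberDistribution π w i = ρ) ↔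
      ∀ i ∈ O, fiberDistribution π₁ w₁ i = ρ := by
    intro O
    change (∀ i ∈ O.map f₁, _) ↔ _
    rw [Finset.forall_mem_map]
    exact forall₂_congr fun i _ => by rw [fiberDistribution_map e₁ f₁ hπ₁ hw₁ hcov₁]
  have hD₂ : ∀ O : Finset Y₂, (∀ i ∈ g₂ O, fiberDistribution π w i = ρ) ↔
      ∀ i ∈ O, fiberDistribution π₂ w₂ i = ρ := by
    intro O
    change (∀ i ∈ O.map f₂, _) ↔ _
    rw [Finset.forall_mem_map]
    exact forall₂_congr fun i _ => by rw [fiberDistribution_map e₂ f₂ hπ₂ hw₂ hcov₂]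
  -- Both parts are invariant under `p`, so each cycle lies entirely in one of them.
  have hcyc : ∀ O, O ∈ cycles p ↔ (∃ P ∈ cycles p₁, g₁ P = O) ∨ ∃ P ∈ cycles p₂, g₂ P = O := by
    intro O
    constructor
    · intro hO
      obtain ⟨i, hi⟩ := Finset.card_pos.1 (card_pos_of_mem_cycles hO)
      rw [eq_cycleThrough_of_mem hO hi]
      rcases hcov i with ⟨j, rfl⟩ | ⟨j, rfl⟩
      · exact Or.inl ⟨_, cycleThrough_mem_cycles p₁ j, (cycleThrough_map f₁ hp₁ j).symm⟩
      · exact Or.inr ⟨_, cycleThrough_mem_cycles p₂ j, (cycleThrough_map f₂ hp₂ j).symm⟩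
    · rintro (⟨P, hP, rfl⟩ | ⟨P, hP, rfl⟩)
      · obtain ⟨i, hi⟩ := Finset.card_pos.1 (card_pos_of_mem_cycles hP)
        rw [eq_cycleThrough_of_mem hP hi]
        change (cycleThrough p₁ i).map f₁ ∈ _
        rw [← cycleThrough_map f₁ hp₁]
        exact cycleThrough_mem_cycles p _
      · obtain ⟨i, hi⟩ := Finset.card_pos.1 (card_pos_of_mem_cycles hP)
        rw [eq_cycleThrough_of_mem hP hi]
        change (cycleThrough p₂ i).map f₂ ∈ _
        rw [← cycleThrough_map f₂ hp₂]
        exact cycleThrough_mem_cycles p _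
  have hd : Disjoint (F₁.map g₁) (F₂.map g₂) := by
    rw [Finset.disjoint_left]
    intro O h₁ h₂
    obtain ⟨P, hP, rfl⟩ := Finset.mem_map.1 h₁
    obtain ⟨Q, hQ, hQP⟩ := Finset.mem_map.1 h₂
    obtain ⟨j, hj⟩ := Finset.card_pos.1 (card_pos_of_mem_cycles (Finset.mem_filter.1 hQ).1)
    have : f₂ j ∈ g₁ P := by
      rw [← hQP]
      exact Finset.mem_map_of_mem f₂ hj
    obtain ⟨i, -, hi⟩ := Finset.mem_map.1 this
    exact hdisj i j hi
  have hF : ((cycles p).filter fun O => ∀ i ∈ O, fiberDistribution π w i = ρ)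
      = (F₁.map g₁).disjUnion (F₂.map g₂) hd := by
    ext O
    rw [Finset.mem_filter, hcyc, Finset.mem_disjUnion, Finset.mem_map, Finset.mem_map]
    constructor
    · rintro ⟨⟨P, hP, rfl⟩ | ⟨P, hP, rfl⟩, h⟩
      · exact Or.inl ⟨P, Finset.mem_filter.2 ⟨hP, (hD₁ P).1 h⟩, rfl⟩
      · exact Or.inr ⟨P, Finset.mem_filter.2 ⟨hP, (hD₂ P).1 h⟩, rfl⟩
    · rintro (⟨P, hP, rfl⟩ | ⟨P, hP, rfl⟩)
      · exact ⟨Or.inl ⟨P, (Finset.mem_filter.1 hP).1, rfl⟩,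
          (hD₁ P).2 (Finset.mem_filter.1 hP).2⟩
      · exact ⟨Or.inr ⟨P, (Finset.mem_filter.1 hP).1, rfl⟩,
          (hD₂ P).2 (Finset.mem_filter.1 hP).2⟩
  unfold fiberTypeParts
  rw [hF, Finset.disjUnion_val, Multiset.map_add, Finset.map_val, Finset.map_val,
    Multiset.map_map, Multiset.map_map]
  congr 1
  · exact Multiset.map_congr rfl fun O _ => Finset.card_map _
  · exact Multiset.map_congr rfl fun O _ => Finset.card_map _

end Systems

/-! ### Points as pairs of a block and a position -/

/-- The block and the position in the block of a point. -/
def blockEquiv (n : ℕ) : Fin (3 * n) ≃ Fin n × Fin 3 where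
  toFun a := (blockOf a, ⟨a.val % 3, Nat.mod_lt _ (by norm_num)⟩)
  invFun x := ⟨3 * x.1.val + x.2.val, by have := x.1.isLt; have := x.2.isLt; omega⟩
  left_inv a := by
    ext
    simp only [blockOf]
    omega
  right_inv x := by
    have := x.2.isLt
    ext
    · simp only [blockOf]
      omega
    · simp only
      omega

theorem blockOf_blockEquiv_symm {n : ℕ} (x : Fin n × Fin 3) :
    blockOf ((blockEquiv n).symm x) = x.1 :=
  congrArg Prod.fst ((blockEquiv n).apply_symm_apply x)

theorem card_block {n : ℕ} (i : Fin n) : (block i).card = 3 := by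
  have : block i = (Finset.univ : Finset (Fin 3)).map
      ⟨fun k => (blockEquiv n).symm (i, k), fun k l h => by simpa using h⟩ := by
    ext a
    simp only [mem_block, Finset.mem_map, Finset.mem_univ, true_and]
    constructor
    · rintro rfl
      exact ⟨(blockEquiv n a).2, (blockEquiv n).symm_apply_apply a⟩
    · rintro ⟨k, rfl⟩
      exact blockOf_blockEquiv_symm _
  rw [this, Finset.card_map]
  rfl

/-- All blocks have three elements, so an image contained in a block fills it. -/
theorem mem_B_iff {n : ℕ} {w : Equiv.Perm (Fin (3 * n))} :
    w ∈ B n ↔ ∀ a b, blockOf a = blockOf b → blockOf (w a) = blockOf (w b) := by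
  constructor
  · exact fun hw a b h => blockOf_eq_of_maps hw h
  · intro h r
    refine ⟨blockOf (w (blockRep r)), Finset.eq_of_subset_of_card_le ?_ ?_⟩
    · intro a ha
      obtain ⟨b, hb, rfl⟩ := Finset.mem_map.1 ha
      exact mem_block.2 (h _ _ ((mem_block.1 hb).trans (blockOf_blockRep r).symm))
    · rw [Finset.card_map, card_block, card_block]

/-! ### Conjugacy -/

/-- Conjugating `w` by itself changes nothing. Hence the distribution is constant on cycles, and the
condition in `typeParts` can be tested at one block. -/
theorem distribution_blockPerm {n : ℕ} (w : B n) (i : Fin n) :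
    distribution w (blockPerm w i) = distribution w i := by
  have := distribution_conj w w i
  rwa [mul_inv_cancel_right] at this

theorem distribution_eq_of_sameCycle {n : ℕ} {w : B n} {i j : Fin n}
    (h : (blockPerm w).SameCycle i j) : distribution w j = distribution w i := by
  obtain ⟨k, rfl⟩ := h
  have := proj_zpow (π := distribution w) (w := blockPerm w) (p := 1) (distribution_blockPerm w) k i
  rwa [one_zpow] at this

theorem forall_distribution_iff {n : ℕ} {w : B n} {O : Finset (Fin n)}
    (hO : O ∈ cycles (blockPerm w)) {i : Fin n} (hi : i ∈ O) (ρ : Multiset ℕ) :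
    (∀ j ∈ O, distribution w j = ρ) ↔ distribution w i = ρ := by
  constructor
  · exact fun h => h i hi
  · rintro rfl j hj
    rw [eq_cycleThrough_of_mem hO hi] at hj
    exact distribution_eq_of_sameCycle (mem_cycleThrough.1 hj)

theorem blockOf_zpow {n : ℕ} (w : B n) (k : ℤ) (a : Fin (3 * n)) :
    blockOf ((w.1 ^ k) a) = (blockPerm w ^ k) (blockOf a) :=
  proj_zpow (fun a => (blockPerm_blockOf w a).symm) k a

/-- The restriction to a block of the first power of `w` that preserves it. -/
def returnMap {n : ℕ} (w : B n) (i : Fin n) : Equiv.Perm {a : Fin (3 * n) // blockOf a = i} :=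
  (w.1 ^ ((cycleThrough (blockPerm w) i).card : ℤ)).subtypePerm fun a => by
    have h := (zpow_apply_eq_self_iff (blockPerm w) i _).2 (dvd_refl _)
    rw [blockOf_zpow]
    exact ⟨fun ha => Equiv.injective _ (ha.trans h.symm), fun ha => ha.symm ▸ h⟩

theorem coe_returnMap_zpow {n : ℕ} (w : B n) (i : Fin n) (m : ℤ)
    (a : {a : Fin (3 * n) // blockOf a = i}) :
    ((returnMap w i ^ m) a).1
      = (w.1 ^ (((cycleThrough (blockPerm w) i).card : ℤ) * m)) a.1 := by
  rw [returnMap, Equiv.Perm.subtypePerm_zpow, zpow_mul]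
  rfl

/-- A power of `w` that relates two points of one block has exponent divisible by the length of the
cycle of that block, so it acts there as a power of the return map. -/
theorem distribution_eq_cycles_returnMap {n : ℕ} (w : B n) (i : Fin n) :
    distribution w i = (cycles (returnMap w i)).val.map Finset.card := by
  rw [distribution_eq]
  refine fiberDistribution_eq_map_card_cycles _ Subtype.val Subtype.val_injective (by simp) ?_
  intro x y
  constructor
  · rintro ⟨k, hk⟩
    have h := congrArg blockOf hk
    rw [blockOf_zpow, x.2, y.2, zpow_apply_eq_self_iff] at h
    obtain ⟨m, rfl⟩ := h
    exact ⟨m, Subtype.ext ((coe_returnMap_zpow w i m x).trans hk)⟩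
  · rintro ⟨m, rfl⟩
    exact ⟨_, (coe_returnMap_zpow w i m x).symm⟩

theorem eq_of_sum_eq_three {s : Multiset ℕ} (hpos : ∀ {c}, c ∈ s → 0 < c) (hsum : s.sum = 3) :
    s = {1, 1, 1} ∨ s = {2, 1} ∨ s = {3} := by
  induction s using Quotient.inductionOn with | _ l
  change ∀ {c}, c ∈ l → 0 < c at hpos
  change (l : Multiset ℕ).sum = 3 at hsum
  rw [Multiset.sum_coe] at hsum
  change (l : Multiset ℕ) = _ ∨ (l : Multiset ℕ) = _ ∨ (l : Multiset ℕ) = _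
  rcases l with _ | ⟨a, _ | ⟨b, _ | ⟨c, _ | ⟨d, l⟩⟩⟩⟩
  · simp at hsum
  · obtain rfl : a = 3 := by simpa using hsum
    decide
  · have ha : 0 < a := hpos (by simp)
    have hb : 0 < b := hpos (by simp)
    simp only [List.sum_cons, List.sum_nil] at hsum
    obtain ⟨rfl, rfl⟩ | ⟨rfl, rfl⟩ : (a = 1 ∧ b = 2) ∨ (a = 2 ∧ b = 1) := by omega
    all_goals decide
  · have ha : 0 < a := hpos (by simp)
    have hb : 0 < b := hpos (by simp)
    have hc : 0 < c := hpos (by simp)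
    simp only [List.sum_cons, List.sum_nil] at hsum
    obtain ⟨rfl, rfl, rfl⟩ : a = 1 ∧ b = 1 ∧ c = 1 := by omega
    decide
  · have ha : 0 < a := hpos (by simp)
    have hb : 0 < b := hpos (by simp)
    have hc : 0 < c := hpos (by simp)
    have hd : 0 < d := hpos (by simp)
    simp only [List.sum_cons] at hsum
    omega

theorem distribution_cases {n : ℕ} (w : B n) (i : Fin n) :
    distribution w i = {1, 1, 1} ∨ distribution w i = {2, 1} ∨ distribution w i = {3} := by
  have hcard : Fintype.card {a : Fin (3 * n) // blockOf a = i} = 3 := by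
    rw [Fintype.card_subtype]
    exact card_block i
  have hsum := sum_map_card_cycles (returnMap w i)
  rw [← distribution_eq_cycles_returnMap, hcard] at hsum
  have hpos : ∀ {c}, c ∈ distribution w i → 0 < c := by
    intro c hc
    rw [distribution_eq_cycles_returnMap] at hc
    obtain ⟨O, hO, rfl⟩ := Multiset.mem_map.1 hc
    exact card_pos_of_mem_cycles hO
  exact eq_of_sum_eq_three hpos hsum

theorem count_typeParts {n : ℕ} (w : B n) (ρ : Multiset ℕ) (r : ℕ) :
    (typeParts w ρ).count r = ((cycles (blockPerm w)).filter fun O =>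
      O.card = r ∧ ∀ i ∈ O, distribution w i = ρ).card := by
  rw [typeParts, count_map_card, Finset.filter_filter]
  congr 1
  exact Finset.filter_congr fun O _ => and_comm

/-- Elements of the same type are conjugate. -/
theorem exists_conj_of_typeParts_eq {n : ℕ} {w w' : B n}
    (h₁ : typeParts w {1, 1, 1} = typeParts w' {1, 1, 1})
    (h₂ : typeParts w {2, 1} = typeParts w' {2, 1}) (h₃ : typeParts w {3} = typeParts w' {3}) :
    ∃ g : B n, g * w * g⁻¹ = w' := by
  have hne : ∀ (v : B n) (O : {O // O ∈ cycles (blockPerm v)}), ∃ i, i ∈ O.1 := fun v O =>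
    Finset.card_pos.1 (card_pos_of_mem_cycles O.2)
  choose b hb using hne
  have hcount : ∀ (v : B n) (c : ℕ × Multiset ℕ),
      (Finset.univ.filter fun O : {O // O ∈ cycles (blockPerm v)} =>
        (O.1.card, distribution v (b v O)) = c).card = (typeParts v c.2).count c.1 := by
    intro v c
    rw [count_typeParts, ← card_filter_attach (cycles (blockPerm v))
      fun O => O.card = c.1 ∧ ∀ i ∈ O, distribution v i = c.2]
    congr 1
    refine Finset.filter_congr fun O _ => ?_
    rw [Prod.ext_iff, forall_distribution_iff O.2 (hb v O)]
  -- No other distribution occurs, so the three hypotheses settle every `ρ`.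
  have hρ : ∀ ρ, typeParts w ρ = typeParts w' ρ := by
    intro ρ
    by_cases hρ : ρ = {1, 1, 1} ∨ ρ = {2, 1} ∨ ρ = {3}
    · rcases hρ with rfl | rfl | rfl <;> assumption
    · have hz : ∀ v : B n, typeParts v ρ = 0 := by
        intro v
        rw [typeParts, Multiset.map_eq_zero, Finset.val_eq_zero, Finset.filter_eq_empty_iff]
        intro O hO h
        apply hρ
        rw [← h _ (hb v ⟨O, hO⟩)]
        exact distribution_cases _ _
      rw [hz, hz]
  obtain ⟨e, he⟩ := exists_fiber_equiv
    (fun O : {O // O ∈ cycles (blockPerm w)} => (O.1.card, distribution w (b w O)))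
    (fun O : {O // O ∈ cycles (blockPerm w')} => (O.1.card, distribution w' (b w' O)))
    (fun c => by rw [hcount, hcount, hρ])
  have hcard : ∀ O, (e O).1.card = O.1.card := fun O => congrArg Prod.fst (he O)
  -- Matched cycles have equal distributions, so their return maps have equal cycle lengths and are
  -- conjugate.
  have hconj : ∀ O, ∃ φ : {a // blockOf a = b w O} ≃ {a // blockOf a = b w' (e O)},
      ∀ x, φ (returnMap w _ x) = returnMap w' _ (φ x) := by
    intro O
    apply exists_conj_of_map_card_cycles_eq
    rw [← distribution_eq_cycles_returnMap, ← distribution_eq_cycles_returnMap]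
    exact (congrArg Prod.snd (he O)).symm
  choose φ hφ using hconj
  obtain ⟨g, hg, hgB⟩ := exists_equivariant_equiv (π := blockOf) (π' := blockOf)
    (fun a => (blockPerm_blockOf w a).symm) (fun a => (blockPerm_blockOf w' a).symm) rfl
    e e.injective hcard (b w) (hb w) (fun O => b w' (e O)) (fun O => hb w' (e O))
    (fun O x => (φ O x).1) (fun O x => (φ O x).2)
    (fun O => Subtype.val_injective.comp (φ O).injective) (by
      intro O m x y hy
      have h1 := coe_returnMap_zpow w (b w O) m x
      rw [← eq_cycleThrough_of_mem O.2 (hb w O), ← hy] at h1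
      have h2 := coe_returnMap_zpow w' (b w' (e O)) m (φ O x)
      rw [← eq_cycleThrough_of_mem (e O).2 (hb w' (e O)), hcard] at h2
      rw [← h2, ← proj_zpow (π := φ O) (hφ O), Subtype.ext h1])
  refine ⟨⟨g, mem_B_iff.2 hgB⟩, ?_⟩
  rw [mul_inv_eq_iff_eq_mul]
  exact Subtype.ext (Equiv.ext hg)

/-! ### Disjoint unions -/

/-- The points of a disjoint union of blocks. -/
def joinPoints {t k n : ℕ} (f : Fin t ⊕ Fin k ≃ Fin n) : Fin (3 * t) ⊕ Fin (3 * k) ≃ Fin (3 * n) :=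
  ((blockEquiv t).sumCongr (blockEquiv k)).trans ((Equiv.sumProdDistrib _ _ _).symm.trans
    ((f.prodCongr (Equiv.refl _)).trans (blockEquiv n).symm))

section Join

variable {t k n : ℕ} (f : Fin t ⊕ Fin k ≃ Fin n)

theorem blockOf_joinPoints_inl (a : Fin (3 * t)) :
    blockOf (joinPoints f (Sum.inl a)) = f (Sum.inl (blockOf a)) :=
  blockOf_blockEquiv_symm _

theorem blockOf_joinPoints_inr (a : Fin (3 * k)) :
    blockOf (joinPoints f (Sum.inr a)) = f (Sum.inr (blockOf a)) :=
  blockOf_blockEquiv_symm _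

/-- The disjoint union of two block permutations. -/
def join (u : B t) (v : B k) : B n :=
  ⟨(joinPoints f).permCongr (Equiv.sumCongr u.1 v.1), mem_B_iff.2 <| by
    intro a b h
    obtain ⟨a, rfl⟩ := (joinPoints f).surjective a
    obtain ⟨b, rfl⟩ := (joinPoints f).surjective b
    rcases a with a | a <;> rcases b with b | b <;>
      simp only [blockOf_joinPoints_inl, blockOf_joinPoints_inr, EmbeddingLike.apply_eq_iff_eq,
        Sum.inl.injEq, Sum.inr.injEq, reduceCtorEq] at h
    · simpa [blockOf_joinPoints_inl] using blockOf_apply u h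
    · simpa [blockOf_joinPoints_inr] using blockOf_apply v h⟩

theorem join_apply_inl (u : B t) (v : B k) (a : Fin (3 * t)) :
    (join f u v).1 (joinPoints f (Sum.inl a)) = joinPoints f (Sum.inl (u.1 a)) := by
  simp [join]

theorem join_apply_inr (u : B t) (v : B k) (a : Fin (3 * k)) :
    (join f u v).1 (joinPoints f (Sum.inr a)) = joinPoints f (Sum.inr (v.1 a)) := by
  simp [join]

theorem blockPerm_join_inl (u : B t) (v : B k) (i : Fin t) :
    blockPerm (join f u v) (f (Sum.inl i)) = f (Sum.inl (blockPerm u i)) := by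
  rw [← blockOf_blockRep i, ← blockOf_joinPoints_inl, blockPerm_blockOf, join_apply_inl,
    blockOf_joinPoints_inl, blockPerm_blockOf]

theorem blockPerm_join_inr (u : B t) (v : B k) (i : Fin k) :
    blockPerm (join f u v) (f (Sum.inr i)) = f (Sum.inr (blockPerm v i)) := by
  rw [← blockOf_blockRep i, ← blockOf_joinPoints_inr, blockPerm_blockOf, join_apply_inr,
    blockOf_joinPoints_inr, blockPerm_blockOf]

theorem typeParts_join (u : B t) (v : B k) (ρ : Multiset ℕ) :
    typeParts (join f u v) ρ = typeParts u ρ + typeParts v ρ := by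
  rw [typeParts_eq, typeParts_eq, typeParts_eq]
  refine fiberTypeParts_add
    (Function.Embedding.inl.trans (joinPoints f).toEmbedding)
    (Function.Embedding.inl.trans f.toEmbedding)
    (blockOf_joinPoints_inl f) (join_apply_inl f u v) (blockPerm_join_inl f u v) ?_
    (Function.Embedding.inr.trans (joinPoints f).toEmbedding)
    (Function.Embedding.inr.trans f.toEmbedding)
    (blockOf_joinPoints_inr f) (join_apply_inr f u v) (blockPerm_join_inr f u v) ?_ ?_ ?_ ρ
  · intro a i h
    obtain ⟨a | a, rfl⟩ := (joinPoints f).surjective a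
    · exact ⟨a, rfl⟩
    · rw [blockOf_joinPoints_inr] at h
      cases f.injective h
  · intro a i h
    obtain ⟨a | a, rfl⟩ := (joinPoints f).surjective a
    · rw [blockOf_joinPoints_inl] at h
      cases f.injective h
    · exact ⟨a, rfl⟩
  · intro i j h
    cases f.injective h
  · intro i
    obtain ⟨i | i, rfl⟩ := f.surjective i
    · exact Or.inl ⟨i, rfl⟩
    · exact Or.inr ⟨i, rfl⟩

theorem join_mul (u u' : B t) (v v' : B k) :
    join f (u * u') (v * v') = join f u v * join f u' v' := by
  apply Subtype.ext
  ext1 a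
  obtain ⟨a | a, rfl⟩ := (joinPoints f).surjective a
  · simp only [join_apply_inl, Subgroup.coe_mul, Equiv.Perm.mul_apply]
  · simp only [join_apply_inr, Subgroup.coe_mul, Equiv.Perm.mul_apply]

theorem join_one : join f (1 : B t) (1 : B k) = 1 := by
  have := join_mul f (1 : B t) 1 (1 : B k) 1
  rwa [mul_one, mul_one, left_eq_mul] at this

theorem join_left_injective (v : B k) : Function.Injective fun u => join f u v := by
  intro u u' h
  apply Subtype.ext
  ext1 a
  have := congrArg (fun w : B n => w.1 (joinPoints f (Sum.inl a))) h
  simpa [join_apply_inl] using this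

end Join

/-! ### Elements of every type -/

section SingleCycle

variable (m : ℕ) (σ : Equiv.Perm (Fin 3))

/-- The permutation that shifts the `m + 1` blocks cyclically and has return map `σ`. -/
def singleCycle : B (m + 1) :=
  ⟨(blockEquiv (m + 1)).symm.permCongr
    (Equiv.Perm.prodExtendRight 0 σ * (Equiv.addRight (1 : Fin (m + 1))).prodCongr (Equiv.refl _)),
    mem_B_iff.2 <| by
      intro a b h
      simp only [Equiv.permCongr_apply, Equiv.symm_symm, blockOf_blockEquiv_symm,
        Equiv.Perm.mul_apply, Equiv.Perm.fst_prodExtendRight]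
      exact congrArg (· + 1) h⟩

theorem singleCycle_apply (i : Fin (m + 1)) (x : Fin 3) :
    (singleCycle m σ).1 ((blockEquiv (m + 1)).symm (i, x))
      = (blockEquiv (m + 1)).symm (i + 1, if i + 1 = 0 then σ x else x) := by
  simp only [singleCycle, Equiv.permCongr_apply, Equiv.symm_symm, Equiv.apply_symm_apply,
    Equiv.Perm.mul_apply, Equiv.prodCongr_apply, Prod.map_apply, Equiv.coe_addRight,
    Equiv.refl_apply]
  split_ifs with h
  · rw [h, Equiv.Perm.prodExtendRight_apply_eq]
  · rw [Equiv.Perm.prodExtendRight_apply_ne _ h]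

theorem singleCycle_pow_apply (k : ℕ) (hk : k ≤ m) (x : Fin 3) :
    ((singleCycle m σ).1 ^ k) ((blockEquiv (m + 1)).symm (0, x))
      = (blockEquiv (m + 1)).symm (Fin.ofNat (m + 1) k, x) := by
  induction k with
  | zero => rfl
  | succ k ih =>
    have h1 : Fin.ofNat (m + 1) k + 1 = Fin.ofNat (m + 1) (k + 1) := by
      ext
      simp [Fin.val_add]
    have h2 : Fin.ofNat (m + 1) (k + 1) ≠ 0 := by
      rw [Ne, Fin.ext_iff, Fin.val_ofNat, Nat.mod_eq_of_lt (by omega)]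
      simp
    rw [pow_succ', Equiv.Perm.mul_apply, ih (by omega), singleCycle_apply, h1, if_neg h2]

theorem singleCycle_pow_succ_apply (x : Fin 3) :
    ((singleCycle m σ).1 ^ (m + 1)) ((blockEquiv (m + 1)).symm (0, x))
      = (blockEquiv (m + 1)).symm (0, σ x) := by
  have h : Fin.ofNat (m + 1) m + 1 = 0 := by
    simp [Fin.ofNat_eq_cast]
  rw [pow_succ', Equiv.Perm.mul_apply, singleCycle_pow_apply m σ m le_rfl, singleCycle_apply, h,
    if_pos rfl]

theorem cycleThrough_blockPerm_singleCycle (i : Fin (m + 1)) :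
    cycleThrough (blockPerm (singleCycle m σ)) i = Finset.univ := by
  have h0 : ∀ j, (blockPerm (singleCycle m σ)).SameCycle 0 j := by
    intro j
    refine ⟨(j.val : ℤ), ?_⟩
    have h := congrArg blockOf (singleCycle_pow_apply m σ j.val (by omega) 0)
    rw [← zpow_natCast, blockOf_zpow, blockOf_blockEquiv_symm, blockOf_blockEquiv_symm] at h
    rw [h]
    simp [Fin.ofNat_eq_cast]
  ext j
  simp only [mem_cycleThrough, Finset.mem_univ, iff_true]
  exact (h0 i).symm.trans (h0 j)

theorem distribution_singleCycle :
    distribution (singleCycle m σ) 0 = (cycles σ).val.map Finset.card := by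
  rw [distribution_eq]
  refine fiberDistribution_eq_map_card_cycles σ (fun x => (blockEquiv (m + 1)).symm (0, x))
    (fun x y h => by simpa using h) ?_ ?_
  · intro a
    constructor
    · intro h
      refine ⟨(blockEquiv (m + 1) a).2, ?_⟩
      rw [Equiv.symm_apply_eq]
      exact Prod.ext h.symm rfl
    · rintro ⟨x, rfl⟩
      exact blockOf_blockEquiv_symm _
  · intro x y
    constructor
    · rintro ⟨k, hk⟩
      -- The `σ`-cycle of the position is invariant: each shift either keeps the position or applies
      -- `σ` to it.
      let J : Fin (3 * (m + 1)) → Finset (Fin 3) :=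
        fun a => cycleThrough σ (blockEquiv (m + 1) a).2
      have hJ : ∀ a, J ((singleCycle m σ).1 a) = (1 : Equiv.Perm (Finset (Fin 3))) (J a) := by
        intro a
        obtain ⟨⟨i, z⟩, rfl⟩ := (blockEquiv (m + 1)).symm.surjective a
        rw [singleCycle_apply]
        simp only [J, Equiv.apply_symm_apply, Equiv.Perm.one_apply, cycleThrough_eq_iff]
        split_ifs
        · exact Equiv.Perm.sameCycle_apply_left.2 (Equiv.Perm.SameCycle.refl _ _)
        · exact Equiv.Perm.SameCycle.refl _ _
      have := proj_zpow hJ k ((blockEquiv (m + 1)).symm (0, x))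
      rw [hk, one_zpow] at this
      simp only [J, Equiv.apply_symm_apply, Equiv.Perm.one_apply, cycleThrough_eq_iff] at this
      exact this.symm
    · rintro ⟨k, rfl⟩
      have := proj_zpow (π := fun x => (blockEquiv (m + 1)).symm (0, x)) (w := σ)
        (fun x => (singleCycle_pow_succ_apply m σ x).symm) k x
      refine ⟨((m + 1 : ℕ) : ℤ) * k, ?_⟩
      rw [zpow_mul, zpow_natCast]
      exact this.symm

theorem typeParts_singleCycle (ρ : Multiset ℕ) :
    typeParts (singleCycle m σ) ρ
      = if (cycles σ).val.map Finset.card = ρ then {m + 1} else 0 := by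
  have hc : cycles (blockPerm (singleCycle m σ)) = {Finset.univ} := by
    ext O
    rw [Finset.mem_singleton]
    constructor
    · intro hO
      obtain ⟨i, hi⟩ := Finset.card_pos.1 (card_pos_of_mem_cycles hO)
      rw [eq_cycleThrough_of_mem hO hi, cycleThrough_blockPerm_singleCycle]
    · rintro rfl
      rw [← cycleThrough_blockPerm_singleCycle m σ 0]
      exact cycleThrough_mem_cycles _ _
  have hd := forall_distribution_iff (w := singleCycle m σ) (O := Finset.univ) (by simp [hc])
    (Finset.mem_univ 0) ρ
  rw [distribution_singleCycle] at hd
  rw [typeParts, hc, Finset.filter_singleton]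
  simp only [hd]
  split_ifs <;> simp

end SingleCycle

/-- Take the disjoint union of one `singleCycle` with return map `σ` for each part of `s`. -/
theorem exists_typeParts_eq_of_cycles {ρ : Multiset ℕ} (σ : Equiv.Perm (Fin 3))
    (hσ : (cycles σ).val.map Finset.card = ρ) (s : Multiset ℕ) (hs : ∀ {r}, r ∈ s → 0 < r) :
    ∃ w : B s.sum, ∀ ρ', typeParts w ρ' = if ρ = ρ' then s else 0 := by
  induction s using Multiset.induction with
  | empty =>
    refine ⟨1, fun ρ' => ?_⟩
    rw [ite_self]
    rfl
  | cons r s ih =>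
    obtain ⟨w, hw⟩ := ih fun h => hs (Multiset.mem_cons_of_mem h)
    obtain ⟨m, rfl⟩ : ∃ m, r = m + 1 :=
      Nat.exists_eq_succ_of_ne_zero (hs (Multiset.mem_cons_self r s)).ne'
    rw [Multiset.sum_cons]
    refine ⟨join finSumFinEquiv (singleCycle m σ) w, fun ρ' => ?_⟩
    rw [typeParts_join, hw, typeParts_singleCycle, hσ]
    split_ifs
    · exact Multiset.singleton_add _ _
    · rfl

theorem exists_typeParts_eq (x : PartitionTriple) :
    ∃ w : B x.size, typeParts w {1, 1, 1} = x.α.2.parts ∧ typeParts w {2, 1} = x.β.2.parts ∧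
      typeParts w {3} = x.γ.2.parts := by
  obtain ⟨u₁, h₁⟩ := exists_typeParts_eq_of_cycles (ρ := {1, 1, 1}) 1 (by decide) x.α.2.parts
    x.α.2.parts_pos
  obtain ⟨u₂, h₂⟩ := exists_typeParts_eq_of_cycles (ρ := {2, 1}) (Equiv.swap 0 1) (by decide)
    x.β.2.parts x.β.2.parts_pos
  obtain ⟨u₃, h₃⟩ := exists_typeParts_eq_of_cycles (ρ := {3}) (finRotate 3) (by decide)
    x.γ.2.parts x.γ.2.parts_pos
  have hx : x.α.2.parts.sum + x.β.2.parts.sum + x.γ.2.parts.sum = x.size := by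
    rw [x.α.2.parts_sum, x.β.2.parts_sum, x.γ.2.parts_sum, PartitionTriple.size]
  rw [← hx]
  refine ⟨join finSumFinEquiv (join finSumFinEquiv u₁ u₂) u₃, ?_⟩
  have h12 : ({1, 1, 1} : Multiset ℕ) ≠ {2, 1} := by decide
  have h13 : ({1, 1, 1} : Multiset ℕ) ≠ {3} := by decide
  have h23 : ({2, 1} : Multiset ℕ) ≠ {3} := by decide
  simp only [typeParts_join, h₁, h₂, h₃, if_neg h12, if_neg h13, if_neg h23, if_neg h12.symm,
    if_neg h13.symm, if_neg h23.symm, if_true, add_zero, zero_add, and_self]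

theorem typeParts_one (n : ℕ) (ρ : Multiset ℕ) :
    typeParts (1 : B n) ρ = if {1, 1, 1} = ρ then Multiset.replicate n 1 else 0 := by
  induction n with
  | zero =>
    rw [Multiset.replicate_zero, ite_self]
    rfl
  | succ n ih =>
    have h1 : singleCycle 0 1 = 1 := by
      apply Subtype.ext
      ext1 a
      obtain ⟨⟨i, x⟩, rfl⟩ := (blockEquiv 1).symm.surjective a
      rw [singleCycle_apply, Equiv.Perm.one_apply, ite_self, Subsingleton.elim (i + 1) i]
      rfl
    rw [← join_one finSumFinEquiv, typeParts_join, ih, ← h1, typeParts_singleCycle,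
      show (cycles (1 : Equiv.Perm (Fin 3))).val.map Finset.card = {1, 1, 1} by decide]
    split_ifs
    · rw [Multiset.replicate_succ, add_comm, Multiset.singleton_add]
    · rfl

/-! ### Supports -/

/-- The blocks that are not fixed pointwise. -/
def supp {n : ℕ} (w : B n) : Finset (Fin n) :=
  Finset.univ.filter fun i => ∃ a, blockOf a = i ∧ w.1 a ≠ a

theorem notMem_supp {n : ℕ} {w : B n} {i : Fin n} :
    i ∉ supp w ↔ ∀ a, blockOf a = i → w.1 a = a := by
  simp [supp]

theorem supp_mul_subset {n : ℕ} (u v : B n) : supp (u * v) ⊆ supp u ∪ supp v := by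
  intro i
  contrapose
  rw [Finset.mem_union, not_or, notMem_supp, notMem_supp, notMem_supp]
  rintro ⟨hu, hv⟩ a ha
  rw [Subgroup.coe_mul, Equiv.Perm.mul_apply, hv a ha, hu a ha]

theorem blockPerm_mem_supp_conj {n : ℕ} (g w : B n) (i : Fin n) :
    blockPerm g i ∈ supp (g * w * g⁻¹) ↔ i ∈ supp w := by
  rw [← not_iff_not, notMem_supp, notMem_supp]
  constructor
  · intro h a ha
    have := h (g.1 a) (by rw [← blockPerm_blockOf, ha])
    simpa using this
  · intro h a ha
    obtain ⟨a, rfl⟩ := g.1.surjective a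
    rw [← blockPerm_blockOf] at ha
    have := h a (Equiv.injective _ ha)
    simp [this]

/-- On a block preserved by `w` the return map is the restriction of `w`, and distribution `{1, 1,
1}` makes it conjugate to the identity. Thus the support can be read off from the type. -/
theorem notMem_supp_iff_distribution {n : ℕ} {w : B n} {i : Fin n} :
    i ∉ supp w ↔ blockPerm w i = i ∧ distribution w i = {1, 1, 1} := by
  have hone : (cycles (1 : Equiv.Perm (Fin 3))).val.map Finset.card = {1, 1, 1} := by decide
  constructor
  · intro h
    rw [notMem_supp] at h
    constructor
    · have := blockPerm_blockOf w (blockRep i)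
      rwa [h _ (blockOf_blockRep i), blockOf_blockRep] at this
    · rw [distribution_eq, ← hone]
      refine fiberDistribution_eq_map_card_cycles 1 (fun x => (blockEquiv n).symm (i, x))
        (fun x y h => by simpa using h) ?_ ?_
      · intro a
        constructor
        · rintro rfl
          exact ⟨(blockEquiv n a).2, (blockEquiv n).symm_apply_apply a⟩
        · rintro ⟨x, rfl⟩
          exact blockOf_blockEquiv_symm _
      · intro x y
        rw [Equiv.Perm.sameCycle_one]
        constructor
        · rintro ⟨k, hk⟩
          rw [Equiv.Perm.zpow_apply_eq_self_of_apply_eq_self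
            (h _ (blockOf_blockEquiv_symm _))] at hk
          simpa using hk
        · rintro rfl
          exact Equiv.Perm.SameCycle.refl _ _
  · rintro ⟨hi, hd⟩
    rw [notMem_supp]
    intro a ha
    rw [distribution_eq_cycles_returnMap, ← hone] at hd
    obtain ⟨g, hg⟩ := exists_conj_of_map_card_cycles_eq _ _ hd
    have h1 : returnMap w i ⟨a, ha⟩ = ⟨a, ha⟩ := g.injective (hg _)
    have h2 := coe_returnMap_zpow w i 1 ⟨a, ha⟩
    rw [zpow_one, h1, mul_one] at h2
    have h3 : (cycleThrough (blockPerm w) i).card = 1 := by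
      have := (zpow_apply_eq_self_iff (blockPerm w) i 1).1 (by rwa [zpow_one])
      exact_mod_cast Nat.dvd_one.1 (by exact_mod_cast this)
    rw [h3, Nat.cast_one, zpow_one] at h2
    exact h2.symm

/-- The blocks outside the support are exactly the cycles that contribute a part 1 to the first
partition. -/
theorem count_one_add_card_supp {n : ℕ} (w : B n) :
    (typeParts w {1, 1, 1}).count 1 + (supp w).card = n := by
  have h : ((cycles (blockPerm w)).filter fun O =>
      O.card = 1 ∧ ∀ i ∈ O, distribution w i = {1, 1, 1})
      = (supp w)ᶜ.map ⟨fun i => {i}, Finset.singleton_injective⟩ := by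
    ext O
    simp only [Finset.mem_filter, Finset.mem_map, Finset.mem_compl, Function.Embedding.coeFn_mk,
      notMem_supp_iff_distribution]
    constructor
    · rintro ⟨hO, hcard, hd⟩
      obtain ⟨i, rfl⟩ := Finset.card_eq_one.1 hcard
      refine ⟨i, ⟨?_, hd i (Finset.mem_singleton_self i)⟩, rfl⟩
      have : blockPerm w i ∈ ({i} : Finset (Fin n)) := by
        rw [eq_cycleThrough_of_mem hO (Finset.mem_singleton_self i), mem_cycleThrough]
        exact Equiv.Perm.sameCycle_apply_right.2 (Equiv.Perm.SameCycle.refl _ _)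
      exact Finset.mem_singleton.1 this
    · rintro ⟨i, ⟨hi, hd⟩, rfl⟩
      have : cycleThrough (blockPerm w) i = {i} := by
        ext j
        rw [mem_cycleThrough, Finset.mem_singleton]
        constructor
        · rintro ⟨k, rfl⟩
          exact Equiv.Perm.zpow_apply_eq_self_of_apply_eq_self hi k
        · rintro rfl
          exact Equiv.Perm.SameCycle.refl _ _
      refine ⟨?_, Finset.card_singleton i, by simpa using hd⟩
      rw [← this]
      exact cycleThrough_mem_cycles _ _
  rw [count_typeParts, h, Finset.card_map, Finset.card_compl_add_card, Fintype.card_fin]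

theorem sum_typeParts {n : ℕ} (w : B n) :
    (typeParts w {1, 1, 1}).sum + (typeParts w {2, 1}).sum + (typeParts w {3}).sum = n := by
  have h12 : ({1, 1, 1} : Multiset ℕ) ≠ {2, 1} := by decide
  have h13 : ({1, 1, 1} : Multiset ℕ) ≠ {3} := by decide
  have h23 : ({2, 1} : Multiset ℕ) ≠ {3} := by decide
  have h : ∀ ρ, (typeParts w ρ).sum
      = ∑ O ∈ cycles (blockPerm w), if ∀ i ∈ O, distribution w i = ρ then O.card else 0 := by
    intro ρ
    rw [← Finset.sum_filter]
    rfl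
  rw [h, h, h, ← Finset.sum_add_distrib, ← Finset.sum_add_distrib]
  have hn := sum_map_card_cycles (blockPerm w)
  rw [Fintype.card_fin] at hn
  refine Eq.trans (b := ∑ O ∈ cycles (blockPerm w), O.card) ?_ hn
  refine Finset.sum_congr rfl fun O hO => ?_
  obtain ⟨i, hi⟩ := Finset.card_pos.1 (card_pos_of_mem_cycles hO)
  simp only [forall_distribution_iff hO hi]
  rcases distribution_cases w i with hd | hd | hd
  · simp only [hd, if_neg h12, if_neg h13, if_true, add_zero]
  · simp only [hd, if_neg h12.symm, if_neg h23, if_true, add_zero, zero_add]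
  · simp only [hd, if_neg h13.symm, if_neg h23.symm, if_true, zero_add]

/-! ### Types and proper triples -/

theorem sigma_partition_ext {p q : Σ m : ℕ, m.Partition} (h : p.2.parts = q.2.parts) : p = q := by
  obtain ⟨m, p⟩ := p
  obtain ⟨l, q⟩ := q
  obtain rfl : m = l := by
    rw [← p.parts_sum, ← q.parts_sum]
    exact congrArg Multiset.sum h
  rw [show p = q from Nat.Partition.ext h]

theorem type_eq_complete_iff {n : ℕ} {w : B n} {x : PartitionTriple} :
    type w = x.complete n ↔
      typeParts w {1, 1, 1} = x.α.2.parts + Multiset.replicate (n - x.size) 1 ∧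
        typeParts w {2, 1} = x.β.2.parts ∧ typeParts w {3} = x.γ.2.parts := by
  constructor
  · intro h
    exact ⟨congrArg (fun z => z.α.2.parts) h, congrArg (fun z => z.β.2.parts) h,
      congrArg (fun z => z.γ.2.parts) h⟩
  · rintro ⟨h₁, h₂, h₃⟩
    exact PartitionTriple.ext (sigma_partition_ext h₁) (sigma_partition_ext h₂)
      (sigma_partition_ext h₃)

theorem exists_conj_of_type_eq {n : ℕ} {w w' : B n} (h : type w = type w') :
    ∃ g : B n, g * w * g⁻¹ = w' :=
  exists_conj_of_typeParts_eq (congrArg (fun z => z.α.2.parts) h)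
    (congrArg (fun z => z.β.2.parts) h) (congrArg (fun z => z.γ.2.parts) h)

theorem PartitionTriple.size_eq_sum (x : PartitionTriple) :
    x.size = x.α.2.parts.sum + x.β.2.parts.sum + x.γ.2.parts.sum := by
  rw [x.α.2.parts_sum, x.β.2.parts_sum, x.γ.2.parts_sum, PartitionTriple.size]

theorem PartitionTriple.IsProper.count_one {x : PartitionTriple} (hx : x.IsProper) (m : ℕ) :
    (x.α.2.parts + Multiset.replicate m 1).count 1 = m := by
  rw [Multiset.count_add, Multiset.count_eq_zero.2 hx, Multiset.count_replicate_self, zero_add]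

theorem size_le_of_type_eq {n : ℕ} {w : B n} {x : PartitionTriple} (h : type w = x.complete n) :
    x.size ≤ n := by
  have := sum_typeParts w
  rw [type_eq_complete_iff] at h
  rw [h.1, h.2.1, h.2.2, Multiset.sum_add, Multiset.sum_replicate, smul_eq_mul, mul_one] at this
  have := x.size_eq_sum
  omega

/-- Properness leaves only the `n - x.size` added parts equal to 1, and these are the blocks fixed
pointwise. -/
theorem card_supp_of_type_eq {n : ℕ} {w : B n} {x : PartitionTriple} (hx : x.IsProper)
    (h : type w = x.complete n) : (supp w).card = x.size := by
  have h1 := count_one_add_card_supp w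
  have h2 := size_le_of_type_eq h
  rw [(type_eq_complete_iff.1 h).1, hx.count_one] at h1
  omega

theorem exists_type_eq_complete {n : ℕ} {x : PartitionTriple} (hn : x.size ≤ n) :
    ∃ w : B n, type w = x.complete n := by
  obtain ⟨w, h₁, h₂, h₃⟩ := exists_typeParts_eq (x.complete n)
  have hsize : (x.complete n).size = n := by
    change x.α.1 + (n - x.size) + x.β.1 + x.γ.1 = n
    have : x.size = x.α.1 + x.β.1 + x.γ.1 := rfl
    omega
  generalize hm : (x.complete n).size = m at w
  obtain rfl : m = n := hm.symm.trans hsize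
  exact ⟨w, type_eq_complete_iff.2 ⟨h₁, h₂, h₃⟩⟩

theorem exists_proper_type_eq_complete {n : ℕ} (w : B n) :
    ∃ z : PartitionTriple, z.IsProper ∧ type w = z.complete n := by
  let z : PartitionTriple :=
    { α := ⟨_, { parts := (typeParts w {1, 1, 1}).filter (· ≠ 1)
                 parts_pos := fun h => typeParts_pos w _ (Multiset.mem_filter.1 h).1
                 parts_sum := rfl }⟩
      β := typePartition w {2, 1}
      γ := typePartition w {3} }
  have hα : z.α.2.parts + Multiset.replicate ((typeParts w {1, 1, 1}).count 1) 1
      = typeParts w {1, 1, 1} := by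
    rw [← Multiset.filter_eq', add_comm]
    exact Multiset.filter_add_not _ _
  have hn : n - z.size = (typeParts w {1, 1, 1}).count 1 := by
    have h1 := sum_typeParts w
    have h2 : z.size = z.α.2.parts.sum + (typeParts w {2, 1}).sum + (typeParts w {3}).sum := rfl
    rw [← hα, Multiset.sum_add, Multiset.sum_replicate, smul_eq_mul, mul_one] at h1
    omega
  have hz : z.IsProper := fun h =>
    (Multiset.mem_filter.1 (show 1 ∈ (typeParts w {1, 1, 1}).filter (· ≠ 1) from h)).2 rfl
  refine ⟨z, hz, ?_⟩
  rw [type_eq_complete_iff, hn, hα]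
  exact ⟨rfl, rfl, rfl⟩

/-- For proper triples the multiplicity of 1 recovers the number of added parts, which can then be
cancelled. -/
theorem PartitionTriple.IsProper.complete_injective {x y : PartitionTriple} (hx : x.IsProper)
    (hy : y.IsProper) {n : ℕ} (h : x.complete n = y.complete n) : x = y := by
  have hα : x.α.2.parts + Multiset.replicate (n - x.size) 1
      = y.α.2.parts + Multiset.replicate (n - y.size) 1 :=
    congrArg (fun z => z.α.2.parts) h
  have hc := congrArg (Multiset.count 1) hα
  rw [hx.count_one, hy.count_one] at hc
  rw [hc] at hα
  exact PartitionTriple.ext (sigma_partition_ext (add_right_cancel hα))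
    (congrArg (fun z => z.β) h) (congrArg (fun z => z.γ) h)

/-! ### Adding fixed blocks -/

section Extension

variable {t k n : ℕ} (f : Fin t ⊕ Fin k ≃ Fin n)

theorem inl_mem_supp_join (u : B t) (v : B k) (i : Fin t) :
    f (Sum.inl i) ∈ supp (join f u v) ↔ i ∈ supp u := by
  rw [← not_iff_not, notMem_supp, notMem_supp]
  constructor
  · intro h a ha
    have := h (joinPoints f (Sum.inl a)) (by rw [blockOf_joinPoints_inl, ha])
    rw [join_apply_inl] at this
    simpa using this
  · intro h a ha
    obtain ⟨a | a, rfl⟩ := (joinPoints f).surjective a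
    · rw [blockOf_joinPoints_inl] at ha
      rw [join_apply_inl, h a (by simpa using ha)]
    · rw [blockOf_joinPoints_inr] at ha
      cases f.injective ha

theorem inr_notMem_supp_join_one (u : B t) (i : Fin k) :
    f (Sum.inr i) ∉ supp (join f u 1) := by
  rw [notMem_supp]
  intro a ha
  obtain ⟨a | a, rfl⟩ := (joinPoints f).surjective a
  · rw [blockOf_joinPoints_inl] at ha
    cases f.injective ha
  · rw [join_apply_inr]
    rfl

theorem exists_join_one_eq {w : B n} (h : ∀ i, f (Sum.inr i) ∉ supp w) :
    ∃ u : B t, join f u 1 = w := by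
  let w' : Equiv.Perm (Fin (3 * t) ⊕ Fin (3 * k)) := (joinPoints f).symm.permCongr w.1
  have hw' : ∀ a, joinPoints f (w' a) = w.1 (joinPoints f a) := fun a => by simp [w']
  have hr : ∀ a, w' (Sum.inr a) = Sum.inr a := by
    intro a
    apply (joinPoints f).injective
    rw [hw']
    exact notMem_supp.1 (h (blockOf a)) _ (blockOf_joinPoints_inr f a)
  -- A point on the left cannot go to the right, where every point is already its own image.
  have hl : Set.MapsTo w' (Set.range Sum.inl) (Set.range Sum.inl) := by
    rintro _ ⟨a, rfl⟩
    rcases hb : w' (Sum.inl a) with b | b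
    · exact ⟨b, rfl⟩
    · rw [← hr b] at hb
      cases w'.injective hb
  obtain ⟨⟨u, v⟩, huv⟩ := Equiv.Perm.mem_sumCongrHom_range_of_perm_mapsTo_inl hl
  have hu : ∀ a, w.1 (joinPoints f (Sum.inl a)) = joinPoints f (Sum.inl (u a)) := by
    intro a
    rw [← hw', ← huv]
    rfl
  refine ⟨⟨u, mem_B_iff.2 ?_⟩, ?_⟩
  · intro a b hab
    have := blockOf_apply w (a := joinPoints f (Sum.inl a)) (b := joinPoints f (Sum.inl b))
      (by rw [blockOf_joinPoints_inl, blockOf_joinPoints_inl, hab])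
    rw [hu, hu, blockOf_joinPoints_inl, blockOf_joinPoints_inl] at this
    simpa using this
  · apply Subtype.ext
    ext1 a
    obtain ⟨a | a, rfl⟩ := (joinPoints f).surjective a
    · rw [join_apply_inl, hu]
    · rw [join_apply_inr, ← hw', hr]
      rfl

/-- Joining with the identity adds `k` parts 1, which is also the difference between `x.complete t`
and `x.complete n` once `x.size ≤ t`. -/
theorem type_join_one_iff {x : PartitionTriple} (hx : x.IsProper) (hn : x.size ≤ n) (u : B t) :
    type (join f u 1) = x.complete n ↔ type u = x.complete t := by
  have htk : t + k = n := by simpa using Fintype.card_congr f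
  have h12 : ({1, 1, 1} : Multiset ℕ) ≠ {2, 1} := by decide
  have h13 : ({1, 1, 1} : Multiset ℕ) ≠ {3} := by decide
  have key : x.size ≤ t → x.α.2.parts + Multiset.replicate (n - x.size) 1
      = x.α.2.parts + Multiset.replicate (t - x.size) 1 + Multiset.replicate k 1 := by
    intro ht
    rw [add_assoc, ← Multiset.replicate_add]
    congr 2
    omega
  have hcancel : x.size ≤ t → (type (join f u 1) = x.complete n ↔ type u = x.complete t) := by
    intro ht
    rw [type_eq_complete_iff, type_eq_complete_iff]
    simp only [typeParts_join, typeParts_one, if_true, if_neg h12, if_neg h13, add_zero]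
    rw [key ht, add_left_inj]
  constructor
  · intro h
    -- For `x.size ≤ t`: by properness the join has exactly `n - x.size` parts 1, at least `k` of
    -- them from the identity, and `hn` excludes truncated subtraction.
    refine (hcancel ?_).1 h
    have h1 := (type_eq_complete_iff.1 h).1
    rw [typeParts_join, typeParts_one, if_pos rfl] at h1
    have h2 := congrArg (Multiset.count 1) h1
    rw [hx.count_one, Multiset.count_add, Multiset.count_replicate_self] at h2
    omega
  · intro h
    exact (hcancel (size_le_of_type_eq h)).2 h

end Extension

/-! ### Counting factorizations -/

/-- The factorizations of `w` into elements of the classes of `x` and `y`. -/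
noncomputable def factorizations (n : ℕ) (x y : PartitionTriple) (w : B n) :
    Finset (B n × B n) := by
  classical
  exact Finset.univ.filter fun q =>
    type q.1 = x.complete n ∧ type q.2 = y.complete n ∧ q.1 * q.2 = w

/-- The factorizations of `w` whose factors have supports with union `T`. -/
noncomputable def factorizationsOver (n : ℕ) (x y : PartitionTriple) (w : B n)
    (T : Finset (Fin n)) : Finset (B n × B n) :=
  (factorizations n x y w).filter fun q => supp q.1 ∪ supp q.2 = T

theorem mem_factorizations {n : ℕ} {x y : PartitionTriple} {w : B n} {q : B n × B n} :
    q ∈ factorizations n x y w ↔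
      type q.1 = x.complete n ∧ type q.2 = y.complete n ∧ q.1 * q.2 = w := by
  simp [factorizations]

theorem mem_factorizationsOver {n : ℕ} {x y : PartitionTriple} {w : B n} {T : Finset (Fin n)}
    {q : B n × B n} : q ∈ factorizationsOver n x y w T ↔
      (type q.1 = x.complete n ∧ type q.2 = y.complete n ∧ q.1 * q.2 = w) ∧
        supp q.1 ∪ supp q.2 = T := by
  rw [factorizationsOver, Finset.mem_filter, mem_factorizations]

theorem card_factorizationsOver_univ_le_conj {n : ℕ} (x y : PartitionTriple) (w g : B n) :
    (factorizationsOver n x y w Finset.univ).card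
      ≤ (factorizationsOver n x y (g * w * g⁻¹) Finset.univ).card := by
  refine Finset.card_le_card_of_injOn (fun q => (g * q.1 * g⁻¹, g * q.2 * g⁻¹)) ?_ ?_
  · intro q hq
    obtain ⟨⟨h₁, h₂, rfl⟩, hT⟩ := mem_factorizationsOver.1 hq
    refine mem_factorizationsOver.2 ⟨⟨?_, ?_, ?_⟩, ?_⟩
    · exact (type_conj g q.1).trans h₁
    · exact (type_conj g q.2).trans h₂
    · group
    · rw [Finset.eq_univ_iff_forall] at hT ⊢
      intro i
      obtain ⟨i, rfl⟩ := (blockPerm g).surjective i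
      rw [Finset.mem_union, blockPerm_mem_supp_conj, blockPerm_mem_supp_conj, ← Finset.mem_union]
      exact hT i
  · intro q _ q' _ h
    rw [Prod.ext_iff] at h ⊢
    simpa using h

theorem card_factorizationsOver_univ_eq_of_type_eq {n : ℕ} (x y : PartitionTriple) {w w' : B n}
    (h : type w = type w') : (factorizationsOver n x y w Finset.univ).card
      = (factorizationsOver n x y w' Finset.univ).card := by
  refine le_antisymm ?_ ?_
  · obtain ⟨g, rfl⟩ := exists_conj_of_type_eq h
    exact card_factorizationsOver_univ_le_conj x y w g
  · obtain ⟨g, rfl⟩ := exists_conj_of_type_eq h.symm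
    exact card_factorizationsOver_univ_le_conj x y w' g

/-- Factors with supports inside `T` are joins with the identity, and `join` is multiplicative and
injective, so such factorizations are those of `w` in `B t` whose supports cover every block. -/
theorem card_factorizationsOver_join {t k n : ℕ} (f : Fin t ⊕ Fin k ≃ Fin n)
    {x y : PartitionTriple} (hx : x.IsProper) (hy : y.IsProper) (hxn : x.size ≤ n)
    (hyn : y.size ≤ n) (w : B t) {T : Finset (Fin n)} (hl : ∀ i, f (Sum.inl i) ∈ T)
    (hr : ∀ i, f (Sum.inr i) ∉ T) :
    (factorizationsOver n x y (join f w 1) T).card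
      = (factorizationsOver t x y w Finset.univ).card := by
  have hinj : Function.Injective fun u : B t => join f u 1 := join_left_injective f 1
  symm
  refine Finset.card_bij (fun q _ => (join f q.1 1, join f q.2 1)) ?_ ?_ ?_
  · intro q hq
    obtain ⟨⟨h₁, h₂, rfl⟩, hT⟩ := mem_factorizationsOver.1 hq
    refine mem_factorizationsOver.2 ⟨⟨(type_join_one_iff f hx hxn _).2 h₁,
      (type_join_one_iff f hy hyn _).2 h₂, ?_⟩, ?_⟩
    · rw [← join_mul, mul_one]
    · ext i
      obtain ⟨i | i, rfl⟩ := f.surjective i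
      · rw [Finset.mem_union, inl_mem_supp_join, inl_mem_supp_join, ← Finset.mem_union, hT]
        simp [hl]
      · simp [hr, inr_notMem_supp_join_one]
  · intro q _ q' _ h
    rw [Prod.ext_iff] at h
    exact Prod.ext (hinj h.1) (hinj h.2)
  · rintro ⟨u, v⟩ hq
    obtain ⟨⟨h₁, h₂, h₃⟩, hT⟩ := mem_factorizationsOver.1 hq
    dsimp only at h₁ h₂ h₃ hT
    obtain ⟨u, rfl⟩ := exists_join_one_eq f (w := u)
      fun i hi => hr i (hT ▸ Finset.mem_union_left _ hi)
    obtain ⟨v, rfl⟩ := exists_join_one_eq f (w := v)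
      fun i hi => hr i (hT ▸ Finset.mem_union_right _ hi)
    refine ⟨(u, v), mem_factorizationsOver.2 ⟨⟨(type_join_one_iff f hx hxn _).1 h₁,
      (type_join_one_iff f hy hyn _).1 h₂, hinj ?_⟩, ?_⟩, rfl⟩
    · change join f (u * v) 1 = join f w 1
      rw [← h₃, ← join_mul, mul_one]
    · rw [Finset.eq_univ_iff_forall]
      intro i
      have := hl i
      rwa [← hT, Finset.mem_union, inl_mem_supp_join, inl_mem_supp_join, ← Finset.mem_union]
        at this

open Classical in
/-- The number of factorizations, without common fixed blocks, of an element of `B t` of the class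
of `h` into elements of the classes of `x` and `y`. -/
noncomputable def spanningCount (x y h : PartitionTriple) (t : ℕ) : ℕ :=
  -- The default is not reached when `h.size ≤ t`, since such an element then exists.
  if H : ∃ w : B t, type w = h.complete t then
    (factorizationsOver t x y H.choose Finset.univ).card else 0

theorem spanningCount_eq {t : ℕ} (x y : PartitionTriple) {h : PartitionTriple} {w : B t}
    (hw : type w = h.complete t) :
    spanningCount x y h t = (factorizationsOver t x y w Finset.univ).card := by
  have H : ∃ w : B t, type w = h.complete t := ⟨w, hw⟩
  rw [spanningCount, dif_pos H]
  exact card_factorizationsOver_univ_eq_of_type_eq x y (H.choose_spec.trans hw.symm)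

/-- Supports of sizes `x.size` and `y.size` cannot cover more than `x.size + y.size` blocks. -/
theorem spanningCount_eq_zero {x y h : PartitionTriple} {t : ℕ} (hx : x.IsProper)
    (hy : y.IsProper) (ht : x.size + y.size < t) : spanningCount x y h t = 0 := by
  rw [spanningCount]
  split_ifs with H
  · rw [Finset.card_eq_zero, Finset.eq_empty_iff_forall_notMem]
    intro q hq
    obtain ⟨⟨h₁, h₂, -⟩, hT⟩ := mem_factorizationsOver.1 hq
    have := Finset.card_union_le (supp q.1) (supp q.2)
    rw [hT, card_supp_of_type_eq hx h₁, card_supp_of_type_eq hy h₂, Finset.card_univ,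
      Fintype.card_fin] at this
    omega
  · rfl

theorem card_factorizationsOver {n : ℕ} {x y h : PartitionTriple} (hx : x.IsProper)
    (hy : y.IsProper) (hh : h.IsProper) (hxn : x.size ≤ n) (hyn : y.size ≤ n) {w : B n}
    (hw : type w = h.complete n) {T : Finset (Fin n)} (hT : supp w ⊆ T) :
    (factorizationsOver n x y w T).card = spanningCount x y h T.card := by
  -- Number the blocks of `T` and those of its complement separately, so that only the size of `T`
  -- matters.
  let f : Fin T.card ⊕ Fin (Fintype.card {i // i ∉ T}) ≃ Fin n :=
    (Equiv.sumCongr T.equivFin.symm (Fintype.equivFin {i // i ∉ T}).symm).trans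
      (Equiv.sumCompl (· ∈ T))
  have hl : ∀ i, f (Sum.inl i) ∈ T := fun i => (T.equivFin.symm i).2
  have hr : ∀ i, f (Sum.inr i) ∉ T := fun i => ((Fintype.equivFin {i // i ∉ T}).symm i).2
  obtain ⟨w, rfl⟩ := exists_join_one_eq f (w := w) fun i hi => hr i (hT hi)
  rw [card_factorizationsOver_join f hx hy hxn hyn w hl hr]
  exact (spanningCount_eq x y ((type_join_one_iff f hh (size_le_of_type_eq hw) w).1 hw)).symm

/-- Sort by the union of the two supports, written as `supp w ∪ R` with `R` outside `supp w`; the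
summand depends only on the size `j` of `R`. -/
theorem card_factorizations {n : ℕ} {x y h : PartitionTriple} (hx : x.IsProper)
    (hy : y.IsProper) (hh : h.IsProper) (hxn : x.size ≤ n) (hyn : y.size ≤ n) {w : B n}
    (hw : type w = h.complete n) : (factorizations n x y w).card
      = ∑ j ∈ Finset.range (n - h.size + 1),
          (n - h.size).choose j * spanningCount x y h (h.size + j) := by
  have hS := card_supp_of_type_eq hh hw
  have hSc : (supp w)ᶜ.card = n - h.size := by rw [Finset.card_compl, Fintype.card_fin, hS]
  have hmaps : Set.MapsTo (fun q : B n × B n => supp q.1 ∪ supp q.2)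
      (factorizations n x y w) ((supp w)ᶜ.powerset.image fun R => supp w ∪ R) := by
    intro q hq
    obtain ⟨-, -, rfl⟩ := mem_factorizations.1 hq
    refine Finset.mem_image.2 ⟨(supp q.1 ∪ supp q.2) \ supp (q.1 * q.2), ?_,
      Finset.union_sdiff_of_subset (supp_mul_subset _ _)⟩
    rw [Finset.mem_powerset]
    intro i hi
    exact Finset.mem_compl.2 (Finset.mem_sdiff.1 hi).2
  rw [Finset.card_eq_sum_card_fiberwise hmaps, Finset.sum_image]
  · rw [← hSc]
    simp only [← smul_eq_mul]
    rw [← Finset.sum_powerset_apply_card fun j => spanningCount x y h (h.size + j)]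
    refine Finset.sum_congr rfl fun R hR => ?_
    rw [Finset.mem_powerset] at hR
    have hd : Disjoint (supp w) R := 
      Finset.disjoint_left.2 fun i hi hiR => Finset.mem_compl.1 (hR hiR) hi
    rw [← hS, ← Finset.card_union_of_disjoint hd]
    exact card_factorizationsOver hx hy hh hxn hyn hw Finset.subset_union_left
  · intro R hR R' hR' hRR
    have aux : ∀ Q ∈ (supp w)ᶜ.powerset, (supp w ∪ Q) \ supp w = Q := by
      intro Q hQ
      rw [Finset.mem_powerset] at hQ
      rw [Finset.union_sdiff_left, Finset.sdiff_eq_self_iff_disjoint, Finset.disjoint_left]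
      exact fun i hi => Finset.mem_compl.1 (hQ hi)
    rw [← aux R hR, ← aux R' hR']
    exact congrArg (· \ supp w) hRR

/-! ### Structure coefficients -/

theorem coeff_classSum_mul {n : ℕ} (x y : PartitionTriple) (w : B n) :
    (classSum n x * classSum n y).1.coeff w = ((factorizations n x y w).card : ℂ) := by
  classical
  change ((∑ t ∈ conjClass n x, MonoidAlgebra.of ℂ (B n) t)
    * ∑ t ∈ conjClass n y, MonoidAlgebra.of ℂ (B n) t).coeff w = _
  rw [Finset.sum_mul_sum, ← Finset.sum_product', MonoidAlgebra.coeff_sum, Finsupp.finsetSum_apply]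
  simp only [MonoidAlgebra.of_apply, MonoidAlgebra.single_mul_single, mul_one, MonoidAlgebra.coeff_single, Finsupp.single_apply]
  rw [Finset.sum_boole]
  congr 2
  ext q
  rw [Finset.mem_filter, Finset.mem_product, mem_conjClass, mem_conjClass, mem_factorizations,
    and_assoc]

open Classical in
theorem coeff_classSum {n : ℕ} (x : PartitionTriple) (w : B n) :
    (classSum n x).1.coeff w = if type w = x.complete n then 1 else 0 := by
  change (∑ t ∈ conjClass n x, MonoidAlgebra.of ℂ (B n) t).coeff w = _
  rw [MonoidAlgebra.coeff_sum, Finsupp.finsetSum_apply]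
  simp only [MonoidAlgebra.of_apply, MonoidAlgebra.coeff_single, Finsupp.single_apply]
  rw [Finset.sum_ite_eq']
  exact if_congr mem_conjClass rfl rfl

theorem coeff_sum_smul_classSum {n : ℕ} (c : Index n →₀ ℂ) {w : B n} (z : Index n)
    (hw : type w = z.1.complete n) : (c.sum fun z r => r • classSum n z.1).1.coeff w = c z := by
  classical
  have h : ∀ (s : Finset (Index n)), (∑ z ∈ s, c z • classSum n z.1).1.coeff w
      = ∑ z ∈ s, c z * (classSum n z.1).1.coeff w := by
    intro s
    induction s using Finset.induction_on with
    | empty => rfl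
    | insert a s ha ih => rw [Finset.sum_insert ha, Finset.sum_insert ha, ← ih]; rfl
  rw [Finsupp.sum, h]
  simp only [coeff_classSum]
  rw [Finset.sum_eq_single z]
  · rw [if_pos hw, mul_one]
  · intro z' _ hz'
    rw [if_neg, mul_zero]
    intro hw'
    exact hz' (Subtype.ext (z'.2.1.complete_injective z.2.1 (hw'.symm.trans hw)))
  · intro hz
    rw [Finsupp.notMem_support_iff.1 hz, zero_mul]

/-- Every element lies in the class of exactly one proper triple, so one class sum contributes to
each coefficient. -/
theorem isStructureCoefficients_iff {n : ℕ} {x y : PartitionTriple} {c : Index n →₀ ℂ} :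
    IsStructureCoefficients n x y c ↔ ∀ (z : Index n) (w : B n), type w = z.1.complete n →
      c z = (factorizations n x y w).card := by
  constructor
  · intro hc z w hw
    rw [← coeff_classSum_mul, hc, coeff_sum_smul_classSum c z hw]
  · intro hc
    apply Subtype.ext
    apply MonoidAlgebra.coeff_injective
    ext w
    obtain ⟨z, hz, hw⟩ := exists_proper_type_eq_complete w
    rw [coeff_classSum_mul, coeff_sum_smul_classSum c ⟨z, hz, size_le_of_type_eq hw⟩ hw]
    exact (hc _ w hw).symm

/-- Representatives of the classes embed the index set into a finite group; hence any function on it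
is finitely supported. -/
instance finite_index (n : ℕ) : Finite (Index n) := by
  choose w hw using fun z : Index n => exists_type_eq_complete z.2.2
  refine Finite.of_injective w fun z z' h => Subtype.ext (z.2.1.complete_injective z'.2.1 (n := n) ?_)
  rw [← hw, ← hw, h]

theorem existsUnique_structureCoefficients {n : ℕ} {x y : PartitionTriple} (hx : x.IsProper)
    (hy : y.IsProper) (hxn : x.size ≤ n) (hyn : y.size ≤ n) :
    ∃! c : Index n →₀ ℂ, IsStructureCoefficients n x y c := by
  choose w hw using fun z : Index n => exists_type_eq_complete z.2.2
  refine ⟨Finsupp.equivFunOnFinite.symm fun z => ((factorizations n x y (w z)).card : ℂ), ?_, ?_⟩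
  · refine isStructureCoefficients_iff.2 fun z v hv => ?_
    change ((factorizations n x y (w z)).card : ℂ) = _
    rw [card_factorizations hx hy z.2.1 hxn hyn (hw z), card_factorizations hx hy z.2.1 hxn hyn hv]
  · intro c hc
    ext z
    exact isStructureCoefficients_iff.1 hc z (w z) (hw z)

/-- The coefficients of the structure polynomial in the falling factorials. -/
noncomputable def fallingCoefficients (x y h : PartitionTriple) : ℕ →₀ ℚ :=
  Finsupp.onFinset (Finset.range (x.size + y.size + 1))
    -- The cutoff builds the degree bound into the definition; for proper `x` and `y` it discards
    -- only zeros. Division by `j!` turns falling factorials into binomials.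
    (fun j => if h.size + j ≤ x.size + y.size then
      (spanningCount x y h (h.size + j) : ℚ) / j.factorial else 0) (by
    intro j hj
    rw [Finset.mem_range]
    by_contra hlt
    exact hj (if_neg (by omega)))

theorem fallingCoefficients_apply {x y : PartitionTriple} (hx : x.IsProper) (hy : y.IsProper)
    (h : PartitionTriple) (j : ℕ) : fallingCoefficients x y h j
      = (spanningCount x y h (h.size + j) : ℚ) / j.factorial := by
  rw [fallingCoefficients, Finsupp.onFinset_apply]
  split_ifs with hj
  · rfl
  · rw [spanningCount_eq_zero hx hy (by omega), Nat.cast_zero, zero_div]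

theorem eval_fallingFactorial {n m : ℕ} (hmn : m ≤ n) (j : ℕ) :
    ((descPochhammer ℚ j).comp (Polynomial.X - Polynomial.C (m : ℚ))).eval (n : ℚ)
      = j.factorial * (n - m).choose j := by
  rw [Polynomial.eval_comp, Polynomial.eval_sub, Polynomial.eval_X, Polynomial.eval_C,
    ← Nat.cast_sub hmn, descPochhammer_eval_eq_descFactorial,
    Nat.descFactorial_eq_factorial_mul_choose, Nat.cast_mul]

theorem eval_structurePolynomial {n : ℕ} {x y h : PartitionTriple} (hx : x.IsProper)
    (hy : y.IsProper) (hh : h.IsProper) (hxn : x.size ≤ n) (hyn : y.size ≤ n) {w : B n}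
    (hw : type w = h.complete n) :
    ((fallingCoefficients x y h).sum fun j q => Polynomial.C q *
      (descPochhammer ℚ j).comp (Polynomial.X - Polynomial.C (h.size : ℚ))).eval (n : ℚ)
      = (factorizations n x y w).card := by
  have hhn := size_le_of_type_eq hw
  have hterm : ∀ j, fallingCoefficients x y h j * (j.factorial * (n - h.size).choose j)
      = (((n - h.size).choose j * spanningCount x y h (h.size + j) : ℕ) : ℚ) := by
    intro j
    rw [fallingCoefficients_apply hx hy, Nat.cast_mul]
    have : (j.factorial : ℚ) ≠ 0 := Nat.cast_ne_zero.2 j.factorial_ne_zero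
    field_simp
  rw [card_factorizations hx hy hh hxn hyn hw, Finsupp.sum, Polynomial.eval_finsetSum,
    Nat.cast_sum]
  simp only [Polynomial.eval_mul, Polynomial.eval_C, eval_fallingFactorial hhn, ← hterm]
  -- Extend both sums to a common index set: beyond `n - h.size` the binomial vanishes, and off the
  -- support the coefficient does.
  let F := (fallingCoefficients x y h).support ∪ Finset.range (n - h.size + 1)
  rw [Finset.sum_subset (s₂ := F) Finset.subset_union_left,
    Finset.sum_subset (s₁ := Finset.range (n - h.size + 1)) (s₂ := F) Finset.subset_union_right]
  · intro j _ hj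
    rw [Finset.mem_range, not_lt] at hj
    rw [Nat.choose_eq_zero_of_lt (by omega), Nat.cast_zero, mul_zero, mul_zero]
  · intro j _ hj
    rw [Finsupp.notMem_support_iff.1 hj, zero_mul]

/-- The additive form avoids truncated subtraction: if `h.size` exceeds `x.size + y.size`, the
cutoff makes the polynomial zero, of degree `⊥`. -/
theorem degree_structurePolynomial (x y h : PartitionTriple) :
    ((fallingCoefficients x y h).sum fun j q => Polynomial.C q *
      (descPochhammer ℚ j).comp (Polynomial.X - Polynomial.C (h.size : ℚ))).degree
        + (h.size : WithBot ℕ) ≤ ((x.size + y.size : ℕ) : WithBot ℕ) := by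
  by_cases hle : h.size ≤ x.size + y.size
  · obtain ⟨d, hd⟩ := Nat.exists_eq_add_of_le' hle
    rw [hd, Nat.cast_add]
    gcongr
    refine (Polynomial.degree_sum_le _ _).trans (Finset.sup_le fun j hj => ?_)
    have hjd : j ≤ d := by
      by_contra hlt
      rw [Finsupp.mem_support_iff, fallingCoefficients, Finsupp.onFinset_apply,
        if_neg (by omega)] at hj
      exact hj rfl
    refine Polynomial.degree_le_of_natDegree_le ((Polynomial.natDegree_C_mul_le _ _).trans ?_)
    rw [Polynomial.natDegree_comp, Polynomial.natDegree_X_sub_C, mul_one,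
      descPochhammer_natDegree]
    exact hjd
  · have : fallingCoefficients x y h = 0 := by
      ext j
      rw [fallingCoefficients, Finsupp.onFinset_apply, if_neg (by omega)]
      rfl
    rw [this, Finsupp.sum_zero_index, Polynomial.degree_zero, WithBot.bot_add]
    exact bot_le

end BlockPermThree

theorem mainTheorem5 (x y : BlockPermThree.PartitionTriple) (hx : x.IsProper) (hy : y.IsProper) :
    (∀ n : ℕ, x.size ≤ n → y.size ≤ n →
      ∃! c : BlockPermThree.Index n →₀ ℂ, BlockPermThree.IsStructureCoefficients n x y c) ∧
    ∀ (h : BlockPermThree.PartitionTriple) (hh : h.IsProper),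
      ∃ (P : Polynomial ℚ) (a : ℕ →₀ ℚ),
        (∀ j, 0 ≤ a j) ∧
        P = a.sum (fun j q => Polynomial.C q *
          (descPochhammer ℚ j).comp (Polynomial.X - Polynomial.C (h.size : ℚ))) ∧
        P.degree + (h.size : WithBot ℕ) ≤ ((x.size + y.size : ℕ) : WithBot ℕ) ∧
        ∀ n : ℕ, x.size ≤ n → y.size ≤ n → ∀ hn : h.size ≤ n,
          ∀ c : BlockPermThree.Index n →₀ ℂ, BlockPermThree.IsStructureCoefficients n x y c →
            c ⟨h, hh, hn⟩ = ((P.eval (n : ℚ) : ℚ) : ℂ) := by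
  refine ⟨fun n hxn hyn => BlockPermThree.existsUnique_structureCoefficients hx hy hxn hyn,
    fun h hh => ⟨_, BlockPermThree.fallingCoefficients x y h, fun j => ?_, rfl,
      BlockPermThree.degree_structurePolynomial x y h, fun n hxn hyn hn c hc => ?_⟩⟩
  · rw [BlockPermThree.fallingCoefficients_apply hx hy]
    positivity
  · obtain ⟨w, hw⟩ := BlockPermThree.exists_type_eq_complete hn
    rw [BlockPermThree.isStructureCoefficients_iff.1 hc ⟨h, hh, hn⟩ w hw,
      BlockPermThree.eval_structurePolynomial hx hy hh hxn hyn hw, Rat.cast_natCast]
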